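/- Let $k$ be a field; vector spaces, chains, cochains and homology are taken over $k$. **Conventions.** For a simplicial vector space $S$, let $C_*S$ be its chain complex with $\partial=\sum_i(-1)^i d_i$, let $D_*S\subset C_*S$ be the subcomplex spanned by the images of the degeneracies, and $N_*S=C_*S/D_*S$. For a simplicial set $K$, let $kK$ be the simplicial vector space freely spanned by $K$, and $H_i(K)=H_i(N_*kK)$. A simplicial finite set is a simplicial set $K$ such that every $K_n$ is finite. For a space $Y$ and a simplicial set $K$, the cosimplicial mapping space $Y^K$ is the cosimplicial space with $Y^K[n]=\mathrm{Set}(K_n,Y)$ (product topology); a simplicial map $f:K\to K'$ induces by precomposition a map of cosimplicial spaces $f^\#:Y^{K'}\to Y^K$. In the pointed case, for a pointed simplicial set $K_*$ and a pointed space $Y_*$, $Y_*^{K_*}[n]$ is the subspace $\mathrm{Set}_*((K_*)_n,Y_*)$ of pointed maps. For a cosimplicial space $Z$ and $q\ge 0$, the singular cochains $[p]\mapsto C^q(Z[p])$ form a simplicial vector space; with the singular coboundary $\delta$, the normalized chain complexes $N_*C^q(Z)$ form a bicomplex, whose total complex is $$|NC(Z)|^n=\bigoplus_{q-p=n}N_pC^q(Z),\qquad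 d=\partial-(-1)^p\delta \ \text{ on } N_pC^q(Z),\qquad n\in\mathbf Z .$$ It is contravariantly functorial in $Z$. **Lemma.** Let $K$ and $K'$ be simplicial finite sets, and let $f:K\to K'$ be a simplicial map which induces an isomorphism $H_*(K)\to H_*(K')$. Then for every topological space $Y$ the map $$|NC(f^\#)|^*:|NC(Y^K)|^*\longrightarrow|NC(Y^{K'})|^*$$ is a quasi-isomorphism (it induces an isomorphism on cohomology in every degree $n\in\mathbf Z$). The same holds in the pointed case: if $f:K_*\to K'_*$ is a map of pointed simplicial finite sets which induces an isomorphism $H_*(K_*)\to H_*(K'_*)$ on the homology of the underlying simplicial sets, then for every pointed space $Y_*$ the map $|NC(f^\#)|^*:|NC(Y_*^{K_*})|^*\to|NC(Y_*^{K'_*})|^*$ is a quasi-isomorphism. -/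

import Mathlib

open CategoryTheory Opposite
open scoped Simplicial

universe u v w

noncomputable section

namespace MappingCochains

variable (k : Type w) [Field k]

/-! ### Normalized chains of a simplicial vector space -/

section Normalization

variable {k}

/-- `D_n S`: the subspace of `S_n` spanned by the images of the degeneracy operators
`s_0, …, s_{n-1} : S_{n-1} → S_n`. -/
def degenerate (S : SimplicialObject (ModuleCat.{v} k)) (n : ℕ) : Submodule k (S _⦋n⦌) :=
  match n with
  | 0 => ⊥
  | n + 1 => ⨆ j : Fin (n + 1), LinearMap.range (S.σ j).hom

/-- `C_* S`, with differential `d_0 - d_1 + ⋯ + (-1)^n d_n`. -/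
abbrev chains (S : SimplicialObject (ModuleCat.{v} k)) : ChainComplex (ModuleCat.{v} k) ℕ :=
  (AlgebraicTopology.alternatingFaceMapComplex (ModuleCat.{v} k)).obj S

theorem face_degeneracy_mem (S : SimplicialObject (ModuleCat.{v} k)) {n : ℕ} (a : Fin (n + 1))
    (i : Fin (n + 2)) (h : i ≠ a.castSucc) (h' : i ≠ a.succ) (x : S _⦋n⦌) :
    (S.δ i).hom ((S.σ a).hom x) ∈ degenerate S n := by
  cases n with
  | zero =>
    have := Fin.val_ne_of_ne h
    have := Fin.val_ne_of_ne h'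
    simp at *
    omega
  | succ n =>
    simp only [degenerate]
    rcases lt_or_gt_of_ne h with h | h
    · have ha : a ≠ 0 := by rintro rfl; simp at h
      obtain ⟨b, rfl⟩ := Fin.exists_succ_eq.mpr ha
      have hi : i ≠ Fin.last _ := (h.trans_le (Fin.le_last _)).ne
      obtain ⟨c, rfl⟩ := Fin.exists_castSucc_eq.mpr hi
      have hc : c ≤ b.castSucc := by
        simp only [Fin.lt_def, Fin.le_def, Fin.val_castSucc, Fin.val_succ] at *
        omega
      exact Submodule.mem_iSup_of_mem b
        ⟨(S.δ c).hom x, (congr($(S.δ_comp_σ_of_le hc) x)).symm⟩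
    · have hi : i ≠ 0 := by rintro rfl; simp at h
      obtain ⟨c, rfl⟩ := Fin.exists_succ_eq.mpr hi
      have hc : a < c := by
        have := Fin.val_ne_of_ne h'
        simp only [Fin.lt_def, Fin.val_castSucc, Fin.val_succ] at *
        omega
      have ha : a ≠ Fin.last _ := (hc.trans_le (Fin.le_last _)).ne
      obtain ⟨b, rfl⟩ := Fin.exists_castSucc_eq.mpr ha
      exact Submodule.mem_iSup_of_mem b
        ⟨(S.δ c).hom x, (congr($(S.δ_comp_σ_of_gt hc) x)).symm⟩

theorem degenerate_le_comap_d (S : SimplicialObject (ModuleCat.{v} k)) (i j : ℕ) :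
    degenerate S i ≤ (degenerate S j).comap ((chains S).d i j).hom := by
  by_cases h : (ComplexShape.down ℕ).Rel i j
  · obtain rfl : j + 1 = i := h
    simp only [degenerate]
    refine iSup_le fun a => ?_
    rintro _ ⟨x, rfl⟩
    have key : ((chains S).d (j + 1) j).hom ((S.σ a).hom x) =
        ∑ i : Fin (j + 2), (-1 : ℤ) ^ (i : ℕ) • (S.δ i).hom ((S.σ a).hom x) := by
      simp [chains]
    have hne : a.castSucc ≠ a.succ := (Fin.castSucc_lt_succ (i := a)).ne
    rw [Submodule.mem_comap, key, ← Finset.sum_add_sum_compl {a.castSucc, a.succ},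
      Finset.sum_pair hne]
    have h1 : (S.δ a.castSucc).hom ((S.σ a).hom x) = x := congr($(S.δ_comp_σ_self (i := a)) x)
    have h2 : (S.δ a.succ).hom ((S.σ a).hom x) = x := congr($(S.δ_comp_σ_succ (i := a)) x)
    rw [h1, h2, Fin.val_succ, Fin.val_castSucc, pow_succ, mul_neg_one, neg_smul, add_neg_cancel,
      zero_add]
    refine Submodule.sum_mem _ fun i hi => zsmul_mem ?_ _
    simp only [Finset.mem_compl, Finset.mem_insert, Finset.mem_singleton, not_or] at hi
    exact face_degeneracy_mem S a i hi.1 hi.2 x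
  · intro x _
    simp [(chains S).shape i j h]

theorem degenerate_le_comap_map {S T : SimplicialObject (ModuleCat.{v} k)} (f : S ⟶ T) (n : ℕ) :
    degenerate S n ≤ (degenerate T n).comap (f.app (op ⦋n⦌)).hom := by
  cases n with
  | zero => simp [degenerate]
  | succ n =>
    simp only [degenerate]
    refine iSup_le fun a => ?_
    rintro _ ⟨x, rfl⟩
    refine Submodule.mem_iSup_of_mem a ⟨(f.app (op ⦋n⦌)).hom x, ?_⟩
    exact (congr($(f.naturality (SimplexCategory.σ a).op) x)).symm

/-- The normalized chain complex `N_* S = C_* S / D_* S`. -/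
def normalizedObj (S : SimplicialObject (ModuleCat.{v} k)) : ChainComplex (ModuleCat.{v} k) ℕ where
  X n := ModuleCat.of k ((chains S).X n ⧸ degenerate S n)
  d i j := ModuleCat.ofHom
    ((degenerate S i).mapQ (degenerate S j) ((chains S).d i j).hom (degenerate_le_comap_d S i j))
  shape i j h := by
    ext x
    simp [(chains S).shape i j h]
  d_comp_d' i j l _ _ := by
    ext x
    exact congr(Submodule.Quotient.mk (p := degenerate S l) ($((chains S).d_comp_d i j l) x))

/-- The normalized chain complex, as a functor. -/
def normalized : SimplicialObject (ModuleCat.{v} k) ⥤ ChainComplex (ModuleCat.{v} k) ℕ where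
  obj := normalizedObj
  map {S T} f :=
    { f := fun n => ModuleCat.ofHom ((degenerate S n).mapQ (degenerate T n)
        (f.app (op ⦋n⦌)).hom (degenerate_le_comap_map f n))
      comm' := by
        intro i j _
        refine ModuleCat.hom_ext (Submodule.linearMap_qext _ (LinearMap.ext fun x => ?_))
        exact congr(Submodule.Quotient.mk (p := degenerate T j)
          ($(((AlgebraicTopology.alternatingFaceMapComplex _).map f).comm i j) x)) }
  map_id S := by
    ext n : 1
    refine ModuleCat.hom_ext (Submodule.linearMap_qext _ (LinearMap.ext fun x => ?_))
    rfl
  map_comp f g := by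
    ext n : 1
    refine ModuleCat.hom_ext (Submodule.linearMap_qext _ (LinearMap.ext fun x => ?_))
    rfl

theorem normalized_map_zero (S T : SimplicialObject (ModuleCat.{v} k)) :
    normalized.map (0 : S ⟶ T) = 0 := by
  ext n : 1
  refine ModuleCat.hom_ext (Submodule.linearMap_qext _ (LinearMap.ext fun x => ?_))
  rfl

end Normalization

/-! ### Homology of a simplicial set with coefficients in `k` -/

/-- The simplicial vector space `kK` freely spanned by a simplicial set `K`. -/
def freeModule : SSet.{u} ⥤ SimplicialObject (ModuleCat.{max u w} k) where
  obj K :=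
    { obj := fun n => ModuleCat.of k (K.obj n →₀ k)
      map := fun θ => ModuleCat.ofHom (Finsupp.lmapDomain k k (K.map θ))
      map_id := fun n => by
        ext x : 3
        simp
      map_comp := fun θ η => by
        ext x : 3
        simp }
  map f :=
    { app := fun n => ModuleCat.ofHom (Finsupp.lmapDomain k k (f.app n))
      naturality := fun n m θ => by
        ext x : 3
        simp [← NatTrans.naturality_apply] }
  map_id K := by
    ext n x : 5
    simp
  map_comp f g := by
    ext n x : 5
    simp

/-- `H_i(f) : H_i(K) ⟶ H_i(K')`, where `H_i(K) = H_i(N_* kK)`. -/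
def homologyMap {K K' : SSet.{u}} (f : K ⟶ K') (i : ℕ) :
    (normalized.obj ((freeModule k).obj K)).homology i ⟶
      (normalized.obj ((freeModule k).obj K')).homology i :=
  HomologicalComplex.homologyMap (normalized.map ((freeModule k).map f)) i

/-! ### Singular cochains -/

/-- The cosimplicial vector space `[q] ↦ k^{Sing_q X}` of functions on singular simplices. -/
def singularCochainsCosimplicial (X : TopCat.{v}) :
    CosimplicialObject (ModuleCat.{max v w} k) where
  obj q := ModuleCat.of k ((TopCat.toSSet.obj X).obj (op q) → k)
  map θ := ModuleCat.ofHom (LinearMap.funLeft k k ((TopCat.toSSet.obj X).map θ.op))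
  map_id q := by
    ext φ x
    simp [LinearMap.funLeft]
  map_comp θ η := by
    ext φ x
    simp [LinearMap.funLeft]

/-- The singular cochain complex `C^*(X)` and its contravariant functoriality in `X`. -/
def singularCochains : TopCat.{v}ᵒᵖ ⥤ CochainComplex (ModuleCat.{max v w} k) ℕ where
  obj X := (AlgebraicTopology.alternatingCofaceMapComplex _).obj
    (singularCochainsCosimplicial k X.unop)
  map g := (AlgebraicTopology.alternatingCofaceMapComplex _).map
    { app := fun q => ModuleCat.ofHom
        (LinearMap.funLeft k k ((TopCat.toSSet.map g.unop).app (op q)))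
      naturality := fun q q' θ => by
        ext φ
        funext x
        exact congrArg φ (NatTrans.naturality_apply (TopCat.toSSet.map g.unop) θ.op x).symm }
  map_id X := by
    ext q φ
    rfl
  map_comp f g := by
    ext q φ
    rfl

/-! ### The realization of the bicomplex of a cosimplicial space -/

/-- For fixed `q`, the functor taking a cosimplicial space `Z` to the simplicial vector space
`[p] ↦ C^q(Z[p])`. -/
def cochainsSimplicial (q : ℕ) :
    (CosimplicialObject TopCat.{v})ᵒᵖ ⥤ SimplicialObject (ModuleCat.{max v w} k) where
  obj Z := Z.unop.op ⋙ singularCochains k ⋙ HomologicalComplex.eval _ _ q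
  map g := Functor.whiskerRight (NatTrans.op g.unop)
    (singularCochains k ⋙ HomologicalComplex.eval _ _ q)

/-- The coboundary `δ : C^q(Z[p]) → C^{q'}(Z[p])`, as a map of simplicial vector spaces
(nonzero only for `q' = q + 1`). -/
def coboundary (Z : (CosimplicialObject TopCat.{v})ᵒᵖ) (q q' : ℕ) :
    (cochainsSimplicial k q).obj Z ⟶ (cochainsSimplicial k q').obj Z where
  app p := ((singularCochains k).obj (op (Z.unop.obj p.unop))).d q q'
  naturality _ _ θ := ((singularCochains k).map (Z.unop.op.map θ)).comm q q'

/-- The bicomplex `N_p C^q(Z)`: the first index is the cohomological degree `q`, the second one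
the simplicial degree `p`. -/
def bicomplex : (CosimplicialObject TopCat.{v})ᵒᵖ ⥤
    HomologicalComplex₂ (ModuleCat.{max v w} k) (ComplexShape.up ℕ) (ComplexShape.down ℕ) where
  obj Z :=
    { X := fun q => normalized.obj ((cochainsSimplicial k q).obj Z)
      d := fun q q' => normalized.map (coboundary k Z q q')
      shape := fun q q' h => by
        have : coboundary k Z q q' = 0 := by
          refine NatTrans.ext (funext fun p => ?_)
          exact ((singularCochains k).obj (op (Z.unop.obj p.unop))).shape _ _ h
        rw [this, normalized_map_zero]
      d_comp_d' := fun q q' q'' _ _ => by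
        have : coboundary k Z q q' ≫ coboundary k Z q' q'' = 0 := by
          refine NatTrans.ext (funext fun p => ?_)
          exact ((singularCochains k).obj (op (Z.unop.obj p.unop))).d_comp_d _ _ _
        rw [← normalized.map_comp, this, normalized_map_zero] }
  map g :=
    { f := fun q => normalized.map ((cochainsSimplicial k q).map g)
      comm' := fun q q' _ => by
        rw [← normalized.map_comp, ← normalized.map_comp]
        congr 1
        refine NatTrans.ext (funext fun p => ?_)
        exact ((singularCochains k).map (g.unop.app p.unop).op).comm q q' }
  map_id Z := by
    ext q : 1
    exact (congrArg normalized.map ((cochainsSimplicial k q).map_id Z)).trans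
      (normalized.map_id _)
  map_comp g h := by
    ext q : 1
    exact (congrArg normalized.map ((cochainsSimplicial k q).map_comp g h)).trans
      (normalized.map_comp _ _)

/-- `N_p C^q` sits in total degree `q - p`, and the total differential on it is
`∂ - (-1)^p δ`. -/
instance totalShape :
    TotalComplexShape (ComplexShape.up ℕ) (ComplexShape.down ℕ) (ComplexShape.up ℤ) where
  π qp := (qp.1 : ℤ) - qp.2
  ε₁ qp := -(-1) ^ qp.2
  ε₂ _ := 1
  rel₁ := by
    rintro q q' h p
    simp at h ⊢
    omega
  rel₂ := by
    rintro q p p' h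
    simp at h ⊢
    omega
  ε₂_ε₁ := by
    rintro q q' p p' - h
    simp at h ⊢
    rw [← h, pow_succ]
    simp

/-- `|NC(Z)|^*`, with `|NC(Z)|^n = ⨁_{q - p = n} N_p C^q(Z)`. -/
def realization : (CosimplicialObject TopCat.{v})ᵒᵖ ⥤
    CochainComplex (ModuleCat.{max v w} k) ℤ :=
  bicomplex k ⋙ HomologicalComplex₂.totalFunctor _ _ _ _

/-! ### Cosimplicial mapping spaces -/

/-- The cosimplicial mapping space `Y^K`, with `Y^K[n] = Set(K_n, Y)` in the product topology. -/
def mappingSpace (Y : TopCat.{v}) : SSet.{u}ᵒᵖ ⥤ CosimplicialObject TopCat.{max u v} where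
  obj K :=
    { obj := fun n => TopCat.of (K.unop.obj (op n) → Y)
      map := fun θ => TopCat.ofHom
        { toFun := fun φ x => φ (K.unop.map θ.op x)
          continuous_toFun := by fun_prop }
      map_id := fun n => by
        ext φ
        simp
      map_comp := fun θ η => by
        ext φ
        simp }
  map f :=
    { app := fun n => TopCat.ofHom
        { toFun := fun φ x => φ (f.unop.app (op n) x)
          continuous_toFun := by fun_prop }
      naturality := fun n m θ => by
        ext φ
        simp }
  map_id K := by
    ext n φ
    simp
  map_comp f g := by
    ext n φ
    simp

/-- The space of pointed maps from a pointed set `A` to `(Y, y₀)`, a subspace of the product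
`Y^A`. -/
abbrev PointedMaps (A : Pointed.{u}) (Y : TopCat.{v}) (y₀ : Y) : Type max u v :=
  {φ : A.X → Y // φ A.point = y₀}

/-- Precomposition with a pointed map. -/
def PointedMaps.precomp {A B : Pointed.{u}} (g : A ⟶ B) (Y : TopCat.{v}) (y₀ : Y) :
    C(PointedMaps B Y y₀, PointedMaps A Y y₀) where
  toFun φ := ⟨fun x => φ.1 (g.toFun x), (congrArg φ.1 g.map_point).trans φ.2⟩
  continuous_toFun := by
    have h : Continuous fun (φ : PointedMaps B Y y₀) (x : A.X) => φ.1 (g.toFun x) :=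
      continuous_pi fun x => Continuous.comp
        (continuous_apply (A := fun _ : B.X => (Y : Type v)) (g.toFun x)) continuous_subtype_val
    exact h.subtype_mk _

/-- The cosimplicial mapping space `Y_*^{K_*}` of a simplicial pointed set `K_*` and a pointed
space `(Y, y₀)`: `Y_*^{K_*}[n]` is the space of pointed maps `(K_*)_n → (Y, y₀)`. -/
def pointedMappingSpace (Y : TopCat.{v}) (y₀ : Y) :
    (SimplicialObject Pointed.{u})ᵒᵖ ⥤ CosimplicialObject TopCat.{max u v} where
  obj K :=
    { obj := fun n => TopCat.of (PointedMaps (K.unop.obj (op n)) Y y₀)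
      map := fun θ => TopCat.ofHom (PointedMaps.precomp (K.unop.map θ.op) Y y₀)
      map_id := fun n => by
        ext φ
        simp [PointedMaps.precomp]
      map_comp := fun θ η => by
        ext φ
        simp [PointedMaps.precomp] }
  map f :=
    { app := fun n => TopCat.ofHom (PointedMaps.precomp (f.unop.app (op n)) Y y₀)
      naturality := fun n m θ => by
        refine TopCat.hom_ext (ContinuousMap.ext fun φ => Subtype.ext (funext fun x => ?_))
        exact congrArg φ.1
          (congrFun (congrArg Pointed.Hom.toFun (f.unop.naturality θ.op)) x).symm }
  map_id K := by
    ext n φ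
    simp [PointedMaps.precomp]
  map_comp f g := by
    ext n φ
    simp [PointedMaps.precomp]

/-- The simplicial set underlying a simplicial pointed set. -/
def forgetPoint : SimplicialObject Pointed.{u} ⥤ SSet.{u} :=
  (SimplicialObject.whiskering Pointed.{u} (Type u)).obj (forget Pointed.{u})

end MappingCochains

end

/-! The map `f` is a homotopy equivalence before any space enters. Let `C` be the category of sets
(or pointed sets) and `Free k C` its `k`-linearization. A simplicial object `K` of `C` gives a chain
complex `... → K_2 → K_1 → K_0` in `Free k C`. If `T` is a finite set, the morphisms `T ⟶ K_n` in
`Free k C` form `k[K_n ^ T]`; for pointed `T` the base point is dropped from the exponent. By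
Künneth, a `k`-homology isomorphism `K → K'` induces a quasi-isomorphism `k[K ^ J] → k[K' ^ J]` for
every finite `J`. So `Hom(T, f)` is a quasi-isomorphism for every term `T` of the two complexes, and
the usual degree-by-degree lifting argument, with the terms playing the role of projectives,
produces a homotopy inverse (`exists_homotopyEquiv`).

Any functor from `C` to a `k`-linear category extends linearly to `Free k C`, and additive functors
preserve homotopy equivalences. Applied to `S ↦ C^*(Y^S)`, this gives a homotopy equivalence of
chain complexes of cochain complexes (`exists_homotopyEquiv_comp`), with no condition on `Y`.
Homotopies pass to total complexes (`totalFlipHomotopy`), so no convergence question arises although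
each total degree is an infinite direct sum. Finally the normalized bicomplex is a natural retract
of the unnormalized one, by the Dold–Kan projector `PInfty`.

Künneth (`quasiIso_diagonalMap_tensor`) is proved by dimension shifting: the décalage of `B` is
homotopy equivalent to a constant object and surjects onto `B`, so the long exact sequence and the
five lemma allow induction on the degree. -/

noncomputable section

namespace MappingCochains

open AlgebraicTopology

/-! ### Normalized chains as a homotopy-equivalent retract of all chains. -/

section Normalization

open AlgebraicTopology.DoldKan

variable {k : Type w} [Field k]

/-- The projection `C_* S → N_* S`. -/
def toNormalized (S : SimplicialObject (ModuleCat.{v} k)) : chains S ⟶ normalized.obj S where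
  f n := ModuleCat.ofHom (degenerate S n).mkQ
  comm' i j _ := by
    ext x
    rfl

theorem degenerate_le_ker_PInfty (S : SimplicialObject (ModuleCat.{v} k)) (n : ℕ) :
    degenerate S n ≤ LinearMap.ker ((PInfty : chains S ⟶ chains S).f n).hom := by
  cases n with
  | zero => exact bot_le
  | succ n =>
    refine iSup_le fun a => ?_
    rintro _ ⟨x, rfl⟩
    exact congr($(σ_comp_PInfty S a) x)

/-- The inclusion `N_* S → C_* S` induced by the projector `PInfty`. -/
def ofNormalized (S : SimplicialObject (ModuleCat.{v} k)) : normalized.obj S ⟶ chains S where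
  f n := ModuleCat.ofHom ((degenerate S n).liftQ
    ((PInfty : chains S ⟶ chains S).f n).hom (degenerate_le_ker_PInfty S n))
  comm' i j _ := by
    refine ModuleCat.hom_ext (Submodule.linearMap_qext _ (LinearMap.ext fun x => ?_))
    exact congr($((PInfty : chains S ⟶ chains S).comm i j) x)

theorem toNormalized_comp_ofNormalized (S : SimplicialObject (ModuleCat.{v} k)) :
    toNormalized S ≫ ofNormalized S = PInfty := by
  ext n x
  rfl

/-- The difference is `-QInfty`, which vanishes in degree 0; in higher degrees every summand in
`decomposition_Q` ends with a degeneracy. -/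
theorem PInfty_sub_mem_degenerate (S : SimplicialObject (ModuleCat.{v} k)) (n : ℕ)
    (x : (AlternatingFaceMapComplex.obj S).X n) :
    ((PInfty : chains S ⟶ chains S).f n).hom x - x ∈ degenerate S n := by
  have h : ((PInfty : chains S ⟶ chains S).f n).hom x +
      ((QInfty : chains S ⟶ chains S).f n).hom x = x :=
    congr($(PInfty_f_add_QInfty_f (X := S) n) x)
  have h' : ((PInfty : chains S ⟶ chains S).f n).hom x - x =
      -((QInfty : chains S ⟶ chains S).f n).hom x := by
    rw [sub_eq_iff_eq_add, neg_add_eq_sub, eq_sub_iff_add_eq]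
    exact h
  rw [h']
  refine neg_mem ?_
  cases n with
  | zero =>
    have : ((QInfty : chains S ⟶ chains S).f 0).hom x = 0 := congr($(QInfty_f_0 (X := S)) x)
    rw [this]
    exact zero_mem _
  | succ n =>
    have : ((QInfty : chains S ⟶ chains S).f (n + 1)).hom x = _ :=
      congr(($(decomposition_Q (X := S) n (n + 1))).hom x)
    rw [this, ModuleCat.hom_sum, LinearMap.sum_apply]
    refine Submodule.sum_mem _ fun i _ => ?_
    exact Submodule.mem_iSup_of_mem i.rev ⟨_, rfl⟩

theorem ofNormalized_comp_toNormalized (S : SimplicialObject (ModuleCat.{v} k)) :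
    ofNormalized S ≫ toNormalized S = 𝟙 _ := by
  ext n : 1
  refine ModuleCat.hom_ext (Submodule.linearMap_qext _ (LinearMap.ext fun x => ?_))
  exact (Submodule.Quotient.eq _).2 (PInfty_sub_mem_degenerate S n x)

theorem toNormalized_naturality {S T : SimplicialObject (ModuleCat.{v} k)} (f : S ⟶ T) :
    (alternatingFaceMapComplex _).map f ≫ toNormalized T =
      toNormalized S ≫ normalized.map f := by
  ext n x
  rfl

theorem ofNormalized_naturality {S T : SimplicialObject (ModuleCat.{v} k)} (f : S ⟶ T) :
    ofNormalized S ≫ (alternatingFaceMapComplex _).map f =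
      normalized.map f ≫ ofNormalized T := by
  ext n : 1
  refine ModuleCat.hom_ext (Submodule.linearMap_qext _ (LinearMap.ext fun x => ?_))
  exact congr($(PInfty_f_naturality n f) x).symm

/-- The projection `C_* S → N_* S` is a homotopy equivalence. -/
def normalizedHomotopyEquiv (S : SimplicialObject (ModuleCat.{v} k)) :
    HomotopyEquiv (chains S) (normalized.obj S) where
  hom := toNormalized S
  inv := ofNormalized S
  homotopyHomInvId :=
    (Homotopy.ofEq (toNormalized_comp_ofNormalized S)).trans (homotopyPInftyToId S)
  homotopyInvHomId := Homotopy.ofEq (ofNormalized_comp_toNormalized S)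

instance (S : SimplicialObject (ModuleCat.{v} k)) : QuasiIso (toNormalized S) :=
  (normalizedHomotopyEquiv S).quasiIso_hom

theorem quasiIso_normalized_map_iff {S T : SimplicialObject (ModuleCat.{v} k)} (f : S ⟶ T) :
    QuasiIso (normalized.map f) ↔ QuasiIso ((alternatingFaceMapComplex _).map f) := by
  rw [← quasiIso_iff_comp_left (toNormalized S) (normalized.map f), ← toNormalized_naturality,
    quasiIso_iff_comp_right]

end Normalization

theorem quasiIso_of_homotopy {C ι : Type*} [Category* C] [Preadditive C] [CategoryWithHomology C]
    {c : ComplexShape ι} {K L : HomologicalComplex C c} {f g : K ⟶ L} (h : Homotopy f g)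
    [hf : QuasiIso f] : QuasiIso g := by
  rw [quasiIso_iff] at hf ⊢
  intro i
  rw [quasiIsoAt_iff_isIso_homologyMap, ← h.homologyMap_eq i, ← quasiIsoAt_iff_isIso_homologyMap]
  exact hf i

/-! ### Quasi-isomorphisms in terms of elements. -/

section QuasiIsoElements

variable {k : Type w} [Ring k] {K L : ChainComplex (ModuleCat.{v} k) ℕ} (φ : K ⟶ L) [QuasiIso φ]

theorem exists_d_eq_of_quasiIso (n m : ℕ) (hm : (ComplexShape.down ℕ).next n = m)
    (x : K.X n) (hx : K.d n m x = 0) (y : L.X (n + 1)) (h : φ.f n x = L.d (n + 1) n y) :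
    ∃ z : K.X (n + 1), K.d (n + 1) n z = x := by
  have hmono : Mono (HomologicalComplex.homologyMap φ n) := inferInstance
  rw [HomologicalComplex.mono_homologyMap_iff_up_to_refinements φ (n + 1) n m (by simp) hm]
    at hmono
  -- The universal test object, consisting of all admissible pairs at once. It lies in the universe
  -- of the modules, which `k` itself need not do; surjectivity of the refinement `π` then recovers
  -- the given pair.
  let s : Submodule k (K.X n × L.X (n + 1)) :=
    LinearMap.ker ((K.d n m).hom ∘ₗ LinearMap.fst k _ _) ⊓
      LinearMap.eqLocus ((φ.f n).hom ∘ₗ LinearMap.fst k _ _)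
        ((L.d (n + 1) n).hom ∘ₗ LinearMap.snd k _ _)
  obtain ⟨A', π, hπ, x₁, h₁⟩ := hmono (A := ModuleCat.of k s)
    (ModuleCat.ofHom (LinearMap.fst k _ _ ∘ₗ s.subtype)) (by ext t; exact t.2.1)
    (ModuleCat.ofHom (LinearMap.snd k _ _ ∘ₗ s.subtype)) (by ext t; exact t.2.2)
  obtain ⟨t, ht⟩ := (ModuleCat.epi_iff_surjective π).1 hπ ⟨(x, y), hx, h⟩
  refine ⟨x₁ t, ?_⟩
  have := congr($h₁ t)
  simp only [ModuleCat.comp_apply, ht] at this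
  exact this.symm

theorem exists_cycle_of_quasiIso (n m : ℕ) (hm : (ComplexShape.down ℕ).next n = m)
    (y : L.X n) (hy : L.d n m y = 0) :
    ∃ x : K.X n, K.d n m x = 0 ∧ ∃ z : L.X (n + 1), y = φ.f n x + L.d (n + 1) n z := by
  have hepi : Epi (HomologicalComplex.homologyMap φ n) := inferInstance
  rw [HomologicalComplex.epi_homologyMap_iff_up_to_refinements φ (n + 1) n m (by simp) hm]
    at hepi
  let s : Submodule k (L.X n) := LinearMap.ker (L.d n m).hom
  obtain ⟨A', π, hπ, x₂, h₂, y₁, h₁⟩ := hepi (A := ModuleCat.of k s)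
    (ModuleCat.ofHom s.subtype) (by ext t; exact t.2)
  obtain ⟨t, ht⟩ := (ModuleCat.epi_iff_surjective π).1 hπ ⟨y, hy⟩
  refine ⟨x₂ t, congr($h₂ t), y₁ t, ?_⟩
  have := congr($h₁ t)
  simp only [ModuleCat.comp_apply, ht] at this
  exact this

end QuasiIsoElements

/-! ### Lifting up to homotopy and recognition of homotopy equivalences. -/

section Lifting

variable {k : Type w} [Ring k] {𝓛 : Type u} [Category.{v} 𝓛] [Preadditive 𝓛] [Linear k 𝓛]
  {X Y : ChainComplex 𝓛 ℕ}

/-- The morphism of complexes `Hom(T, f)`. -/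
abbrev homMap (k : Type w) [Ring k] [Linear k 𝓛] (T : 𝓛) (f : X ⟶ Y) :=
  (((linearCoyoneda k 𝓛).obj (op T)).mapHomologicalComplex (ComplexShape.down ℕ)).map f

theorem exists_lift_zero (f : X ⟶ Y) {T : 𝓛} (hT : QuasiIso (homMap k T f)) (b : T ⟶ Y.X 0) :
    ∃ (x : T ⟶ X.X 0) (y : T ⟶ Y.X 1), y ≫ Y.d 1 0 = b - x ≫ f.f 0 := by
  -- In `ComplexShape.down ℕ` the successor of 0 is 0 by default, and `d 0 0 = 0`, so every `b` is a
  -- cycle.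
  obtain ⟨x, -, z, hz⟩ := exists_cycle_of_quasiIso (homMap k T f) 0 0 (by simp) b
    (by simp; rfl)
  refine ⟨x, z, ?_⟩
  rw [eq_sub_iff_add_eq']
  exact hz.symm

/-- Injectivity on homology bounds `a` by some `x₀`. The defect `b - x₀ ≫ f` is then a cycle, and
surjectivity on homology corrects `x₀` by a cycle `x₁`, up to a boundary. -/
theorem exists_lift_succ (f : X ⟶ Y) {T : 𝓛} (hT : QuasiIso (homMap k T f)) (n m : ℕ)
    (hm : (ComplexShape.down ℕ).next n = m)
    (a : T ⟶ X.X n) (ha : a ≫ X.d n m = 0) (b : T ⟶ Y.X (n + 1))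
    (hab : a ≫ f.f n = b ≫ Y.d (n + 1) n) :
    ∃ (x : T ⟶ X.X (n + 1)) (y : T ⟶ Y.X (n + 2)),
      x ≫ X.d (n + 1) n = a ∧ y ≫ Y.d (n + 2) (n + 1) = b - x ≫ f.f (n + 1) := by
  obtain ⟨x₀, hx₀⟩ := exists_d_eq_of_quasiIso (homMap k T f) n m hm a ha b hab
  change T ⟶ X.X (n + 1) at x₀
  replace hx₀ : x₀ ≫ X.d (n + 1) n = a := hx₀
  obtain ⟨x₁, hx₁, z, hz⟩ := exists_cycle_of_quasiIso (homMap k T f) (n + 1) n (by simp)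
    (b - x₀ ≫ f.f (n + 1)) (by
      change (b - x₀ ≫ f.f (n + 1)) ≫ Y.d (n + 1) n = 0
      rw [Preadditive.sub_comp, Category.assoc, f.comm, reassoc_of% hx₀, hab, sub_self])
  change T ⟶ X.X (n + 1) at x₁
  change T ⟶ Y.X (n + 2) at z
  replace hx₁ : x₁ ≫ X.d (n + 1) n = 0 := hx₁
  replace hz : b - x₀ ≫ f.f (n + 1) = x₁ ≫ f.f (n + 1) + z ≫ Y.d (n + 2) (n + 1) := hz
  refine ⟨x₀ + x₁, z, ?_, ?_⟩
  · rw [Preadditive.add_comp, hx₀, hx₁, add_zero]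
  · rw [Preadditive.add_comp, ← sub_sub, hz, add_sub_cancel_left]

variable {P : ChainComplex 𝓛 ℕ} (f : X ⟶ Y) (φ : P ⟶ Y)

/-- A map and a homotopy component in degree `n` which can be extended to degree `n + 1`. -/
structure PartialLift (n : ℕ) where
  map : P.X n ⟶ X.X n
  htpy : P.X n ⟶ Y.X (n + 1)
  -- Both conditions are precomposed with the differential of `P`. This kills the terms from degree
  -- `n - 1`, so the structure refers to a single degree and plain recursion applies.
  d_map_d : P.d (n + 1) n ≫ map ≫ X.d n ((ComplexShape.down ℕ).next n) = 0
  d_htpy_d : P.d (n + 1) n ≫ htpy ≫ Y.d (n + 1) n = P.d (n + 1) n ≫ (φ.f n - map ≫ f.f n)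

variable {f φ}

theorem PartialLift.exists_succ {n : ℕ} (hT : QuasiIso (homMap k (P.X (n + 1)) f))
    (p : PartialLift f φ n) :
    ∃ q : PartialLift f φ (n + 1), q.map ≫ X.d (n + 1) n = P.d (n + 1) n ≫ p.map ∧
      q.htpy ≫ Y.d (n + 2) (n + 1) =
        φ.f (n + 1) - P.d (n + 1) n ≫ p.htpy - q.map ≫ f.f (n + 1) := by
  obtain ⟨x, y, hx, hy⟩ := exists_lift_succ f hT n _ rfl (P.d (n + 1) n ≫ p.map)
    (by rw [Category.assoc, p.d_map_d]) (φ.f (n + 1) - P.d (n + 1) n ≫ p.htpy) (by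
      rw [Preadditive.sub_comp, φ.comm, Category.assoc, Category.assoc, p.d_htpy_d,
        Preadditive.comp_sub, sub_sub_cancel])
  refine ⟨⟨x, y, ?_, ?_⟩, hx, hy⟩
  · obtain h : (ComplexShape.down ℕ).next (n + 1) = n := by simp
    rw [h, hx, ← Category.assoc, P.d_comp_d, Limits.zero_comp]
  · rw [hy, Preadditive.comp_sub, Preadditive.comp_sub, Preadditive.comp_sub,
      ← Category.assoc _ _ p.htpy, P.d_comp_d, Limits.zero_comp, sub_zero]

theorem PartialLift.exists_zero (hT : QuasiIso (homMap k (P.X 0) f)) :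
    ∃ q : PartialLift f φ 0, q.htpy ≫ Y.d 1 0 = φ.f 0 - q.map ≫ f.f 0 := by
  obtain ⟨x, y, h⟩ := exists_lift_zero f hT (φ.f 0)
  exact ⟨⟨x, y, by simp, by rw [h]⟩, h⟩

variable (f φ)

/-- A morphism from `P` lifts up to homotopy along `f` if `Hom(P_n, f)` is a quasi-isomorphism
for all `n`. -/
theorem exists_lift_up_to_homotopy (h : ∀ n, QuasiIso (homMap k (P.X n) f)) :
    ∃ ψ : P ⟶ X, Nonempty (Homotopy (ψ ≫ f) φ) := by
  choose p₀ hp₀ using PartialLift.exists_zero (φ := φ) (h 0)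
  choose s hs using fun n => PartialLift.exists_succ (φ := φ) (h (n + 1))
  let p : ∀ n, PartialLift f φ n := Nat.rec p₀ s
  have hp (n) := hs n (p n)
  change ∀ n, (p (n + 1)).map ≫ _ = _ ∧ (p (n + 1)).htpy ≫ _ = _ - (p (n + 1)).map ≫ _ at hp
  let ψ : P ⟶ X :=
    { f n := (p n).map
      comm' := by
        rintro _ n rfl
        exact (hp n).1 }
  -- The recursion expresses `φ` as `ψ ≫ f` plus homotopy terms, which is a homotopy from `φ` to `ψ
  -- ≫ f`.
  refine ⟨ψ, ⟨Homotopy.symm ⟨fun i j =>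
    if h : i + 1 = j then (p i).htpy ≫ eqToHom (by rw [h]) else 0,
    fun i j hij => dif_neg hij, fun n => ?_⟩⟩⟩
  cases n with
  | zero =>
    rw [prevD_eq _ (show (ComplexShape.down ℕ).Rel 1 0 from rfl), dNext_eq_zero _ _ (by simp)]
    simp [ψ, p, hp₀]
  | succ n =>
    rw [prevD_eq _ (show (ComplexShape.down ℕ).Rel (n + 2) (n + 1) from rfl),
      dNext_eq _ (show (ComplexShape.down ℕ).Rel (n + 1) n from rfl)]
    simp only [ψ, ↓reduceDIte, eqToHom_refl, Category.comp_id, (hp n).2,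
      HomologicalComplex.comp_f]
    abel

/-- A morphism `f : X ⟶ Y` of chain complexes is a homotopy equivalence if `Hom(T, f)` is a
quasi-isomorphism for all the objects `T` which appear in `X` and `Y`. -/
theorem exists_homotopyEquiv (hX : ∀ n, QuasiIso (homMap k (X.X n) f))
    (hY : ∀ n, QuasiIso (homMap k (Y.X n) f)) :
    ∃ e : HomotopyEquiv X Y, e.hom = f := by
  obtain ⟨g, ⟨hg⟩⟩ := exists_lift_up_to_homotopy f (𝟙 Y) hY
  -- Since `g ≫ f` is homotopic to the identity, two-out-of-three makes `g` satisfy the lifting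
  -- hypothesis as well. Hence `g` has its own one-sided inverse `f'`, necessarily homotopic to `f`.
  have hg' (n) : QuasiIso (homMap k (X.X n) g) := by
    have h : QuasiIso (homMap k (X.X n) g ≫ homMap k (X.X n) f) := by
      let Φ := (linearCoyoneda k 𝓛).obj (op (X.X n))
      have e : Homotopy (homMap k (X.X n) (g ≫ f)) (homMap k (X.X n) (𝟙 Y)) := Φ.mapHomotopy hg
      rw [← Functor.map_comp]
      have : QuasiIso (homMap k (X.X n) (𝟙 Y)) := by
        rw [homMap, CategoryTheory.Functor.map_id]
        infer_instance
      exact quasiIso_of_homotopy e.symm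
    exact quasiIso_of_comp_right _ (homMap k (X.X n) f)
  obtain ⟨f', ⟨hf'⟩⟩ := exists_lift_up_to_homotopy g (𝟙 X) hg'
  have h : Homotopy f f' :=
    (Homotopy.ofEq (Category.id_comp f).symm).trans ((hf'.symm.compRight f).trans
      ((Homotopy.ofEq (Category.assoc f' g f)).trans ((hg.compLeft f').trans
        (Homotopy.ofEq (Category.comp_id f')))))
  exact ⟨⟨f, g, (h.compRight g).trans hf', hg⟩, rfl⟩

end Lifting

/-! ### The décalage and its extra degeneracy. -/

section Decalage

/-- The functor `⦋n⦌ ↦ ⦋0⦌ ⋆ ⦋n⦌ = ⦋n + 1⦌`. -/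
def coneFunctor : SimplexCategory ⥤ SimplexCategory where
  obj n := ⦋n.len + 1⦌
  map {n m} θ := SimplexCategory.mkHom
    { toFun := Fin.cases 0 fun i => (θ.toOrderHom i).succ
      monotone' := by
        intro i j
        induction i using Fin.cases with
        | zero => simp
        | succ i =>
          induction j using Fin.cases with
          | zero => simp
          | succ j => simpa using fun h => θ.toOrderHom.monotone h }
  map_id n := by
    ext i : 3
    induction i using Fin.cases <;> rfl
  map_comp θ η := by
    ext i : 3
    induction i using Fin.cases <;> rfl

theorem coneFunctor_map_δ {n : ℕ} (i : Fin (n + 2)) :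
    coneFunctor.map (SimplexCategory.δ i) = SimplexCategory.δ i.succ := by
  ext j : 3
  induction j using Fin.cases with
  | zero => exact (Fin.succ_succAbove_zero i).symm
  | succ j => exact (Fin.succ_succAbove_succ i j).symm

theorem coneFunctor_map_σ {n : ℕ} (i : Fin (n + 1)) :
    coneFunctor.map (SimplexCategory.σ i) = SimplexCategory.σ i.succ := by
  ext j : 3
  induction j using Fin.cases with
  | zero => exact (Fin.predAbove_right_zero (i := i.succ)).symm
  | succ j => exact (Fin.succ_predAbove_succ i j).symm

/-- The inclusion `⦋n⦌ ⟶ ⦋0⦌ ⋆ ⦋n⦌`. -/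
def toCone : 𝟭 SimplexCategory ⟶ coneFunctor where
  app n := SimplexCategory.δ (n := n.len) 0
  naturality n m θ := by
    ext j : 3
    rfl

variable {C : Type u} [Category.{v} C]

/-- The décalage of a simplicial object, with the face `d_0` and the degeneracy `s_0` omitted. -/
def decalage (X : SimplicialObject C) : SimplicialObject C := coneFunctor.op ⋙ X

/-- The morphism given by the omitted face. -/
def decalageTo (X : SimplicialObject C) : decalage X ⟶ X :=
  Functor.whiskerRight (NatTrans.op toCone) X

/-- The décalage is augmented by its vertex `0`. -/
def decalageAugmented (X : SimplicialObject C) : SimplicialObject.Augmented C where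
  left := decalage X
  right := X _⦋0⦌
  hom :=
    { app n := X.map (SimplexCategory.const ⦋0⦌ ⦋n.unop.len + 1⦌ 0).op
      naturality _ _ _ := (X.map_comp _ _).symm.trans (Eq.trans (congrArg (fun η => X.map η)
        (Quiver.Hom.unop_inj rfl)) (Category.comp_id _).symm) }

theorem decalage_δ (X : SimplicialObject C) {n : ℕ} (i : Fin (n + 2)) :
    (decalage X).δ i = X.δ i.succ :=
  congrArg (fun θ => X.map (Quiver.Hom.op θ)) (coneFunctor_map_δ i)

theorem decalage_σ (X : SimplicialObject C) {n : ℕ} (i : Fin (n + 1)) :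
    (decalage X).σ i = X.σ i.succ :=
  congrArg (fun θ => X.map (Quiver.Hom.op θ)) (coneFunctor_map_σ i)

theorem decalageAugmented_hom_app_zero (X : SimplicialObject C) :
    (decalageAugmented X).hom.app (op ⦋0⦌) = X.δ 1 := by
  refine congrArg (fun θ : ⦋0⦌ ⟶ ⦋1⦌ => X.map θ.op) ?_
  ext j : 3
  fin_cases j
  rfl

/-- The omitted degeneracy is an extra degeneracy of the décalage. -/
def decalageExtraDegeneracy (X : SimplicialObject C) :
    (decalageAugmented X).ExtraDegeneracy where
  s' := X.σ 0
  s n := X.σ (n := n + 1) 0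
  s'_comp_ε := (congrArg _ (decalageAugmented_hom_app_zero X)).trans (X.δ_comp_σ_succ (i := 0))
  s₀_comp_δ₁ := by
    rw [decalageAugmented_hom_app_zero]
    refine (congrArg _ (decalage_δ X 1)).trans ?_
    exact X.δ_comp_σ_of_gt (i := 1) (j := 0) (by simp)
  s_comp_δ₀ n := by
    refine (congrArg _ (decalage_δ X 0)).trans ?_
    exact X.δ_comp_σ_succ (i := 0)
  s_comp_δ n i := by
    refine (congrArg _ (decalage_δ X i.succ)).trans ?_
    refine Eq.trans ?_ (congrArg (· ≫ _) (decalage_δ X i)).symm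
    exact X.δ_comp_σ_of_gt (i := i.succ) (j := 0) (by simp)
  s_comp_σ n i := by
    refine (congrArg _ (decalage_σ X i.succ)).trans ?_
    refine Eq.trans ?_ (congrArg (· ≫ _) (decalage_σ X i)).symm
    exact (X.σ_comp_σ (i := 0) (j := i.succ) (by simp)).symm

end Decalage

/-! ### Diagonals of bifunctors and simplicial homotopies. -/

section Bifunctor

variable {C D E : Type*} [Category* C] [Category* D] [Category* E]

/-- The diagonal `⦋n⦌ ↦ F(A_n, B_n)`. -/
abbrev diagonal (F : C × D ⥤ E) (A : SimplicialObject C) (B : SimplicialObject D) :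
    SimplicialObject E :=
  Functor.prod' A B ⋙ F

/-- The functoriality of the diagonal. -/
abbrev diagonalMap (F : C × D ⥤ E) {A A' : SimplicialObject C} {B B' : SimplicialObject D}
    (f : A ⟶ A') (g : B ⟶ B') : diagonal F A B ⟶ diagonal F A' B' :=
  Functor.whiskerRight (NatTrans.prod' f g) F

theorem diagonalMap_comp (F : C × D ⥤ E) {A A' A'' : SimplicialObject C}
    {B B' B'' : SimplicialObject D}
    (f : A ⟶ A') (g : B ⟶ B') (f' : A' ⟶ A'') (g' : B' ⟶ B'') :
    diagonalMap F f g ≫ diagonalMap F f' g' = diagonalMap F (f ≫ f') (g ≫ g') := by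
  ext n
  exact (F.map_comp _ _).symm

theorem diagonalMap_id (F : C × D ⥤ E) (A : SimplicialObject C) (B : SimplicialObject D) :
    diagonalMap F (𝟙 A) (𝟙 B) = 𝟙 _ := by
  ext n
  exact F.map_id _

/-- The product of two simplicial homotopies. -/
def prodHomotopy {A A' : SimplicialObject C} {B B' : SimplicialObject D} {f f' : A ⟶ A'}
    {g g' : B ⟶ B'} (H : SimplicialObject.Homotopy f f') (H' : SimplicialObject.Homotopy g g') :
    SimplicialObject.Homotopy (X := A.prod' B) (Y := A'.prod' B')
      (NatTrans.prod' f g) (NatTrans.prod' f' g') where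
  h i := Prod.mkHom (H.h i) (H'.h i)
  h_zero_comp_δ_zero n := Prod.ext (H.h_zero_comp_δ_zero n) (H'.h_zero_comp_δ_zero n)
  h_last_comp_δ_last n := Prod.ext (H.h_last_comp_δ_last n) (H'.h_last_comp_δ_last n)
  h_succ_comp_δ_castSucc_of_lt i j h := Prod.ext
    (H.h_succ_comp_δ_castSucc_of_lt i j h) (H'.h_succ_comp_δ_castSucc_of_lt i j h)
  h_succ_comp_δ_castSucc_succ j := Prod.ext
    (H.h_succ_comp_δ_castSucc_succ j) (H'.h_succ_comp_δ_castSucc_succ j)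
  h_castSucc_comp_δ_succ_of_lt i j h := Prod.ext
    (H.h_castSucc_comp_δ_succ_of_lt i j h) (H'.h_castSucc_comp_δ_succ_of_lt i j h)
  h_comp_σ_castSucc_of_le i j h := Prod.ext
    (H.h_comp_σ_castSucc_of_le i j h) (H'.h_comp_σ_castSucc_of_le i j h)
  h_comp_σ_succ_of_lt i j h := Prod.ext
    (H.h_comp_σ_succ_of_lt i j h) (H'.h_comp_σ_succ_of_lt i j h)

/-- Simplicial homotopies induce a simplicial homotopy on diagonals. -/
def diagonalHomotopy (F : C × D ⥤ E) {A A' : SimplicialObject C} {B B' : SimplicialObject D}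
    {f f' : A ⟶ A'} {g g' : B ⟶ B'} (H : SimplicialObject.Homotopy f f')
    (H' : SimplicialObject.Homotopy g g') :
    SimplicialObject.Homotopy (diagonalMap F f g) (diagonalMap F f' g') :=
  (prodHomotopy H H').whiskerRight F

end Bifunctor

/-! ### Replacing a décalage by a constant object. -/

section QuasiIso

variable {C D E : Type*} [Category* C] [Category* D] [Category* E] [Abelian E]

/-- The homotopy given by the extra degeneracy is simplicial, so it survives any bifunctor `F`,
additive or not; alternating sums are taken only afterwards. -/
theorem quasiIso_diagonalMap_section (F : C × D ⥤ E) (A : SimplicialObject C)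
    {X : SimplicialObject.Augmented D} (ed : X.ExtraDegeneracy) :
    QuasiIso ((alternatingFaceMapComplex E).map (diagonalMap F (𝟙 A) ed.section_)) := by
  let e : HomotopyEquiv ((alternatingFaceMapComplex E).obj (diagonal F A
      ((SimplicialObject.const D).obj X.right)))
      ((alternatingFaceMapComplex E).obj (diagonal F A X.left)) :=
    { hom := (alternatingFaceMapComplex E).map (diagonalMap F (𝟙 A) ed.section_)
      inv := (alternatingFaceMapComplex E).map (diagonalMap F (𝟙 A) X.hom)
      homotopyHomInvId := Homotopy.ofEq (by
        rw [← Functor.map_comp, diagonalMap_comp, ed.section_comp_hom, Category.comp_id,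
          diagonalMap_id]
        exact CategoryTheory.Functor.map_id _ _)
      homotopyInvHomId := (Homotopy.ofEq (by
        rw [← Functor.map_comp, diagonalMap_comp, Category.comp_id])).trans
        ((diagonalHomotopy F (.refl (𝟙 A)) ed.homotopy).toChainHomotopy.trans
          (Homotopy.ofEq ((congrArg _ (diagonalMap_id F A X.left)).trans
            (CategoryTheory.Functor.map_id _ _)))) }
  exact e.quasiIso_hom

/-- If `F(f, -)` is a quasi-isomorphism on constant simplicial objects, then it is one on
décalages. -/
theorem quasiIso_diagonalMap_decalage (F : C × D ⥤ E) {A A' : SimplicialObject C} (f : A ⟶ A')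
    (h : ∀ V : D, QuasiIso ((alternatingFaceMapComplex E).map
      (diagonalMap F f (𝟙 ((SimplicialObject.const D).obj V))))) (B : SimplicialObject D) :
    QuasiIso ((alternatingFaceMapComplex E).map (diagonalMap F f (𝟙 (decalage B)))) := by
  have := h (B _⦋0⦌)
  have h₁ := quasiIso_diagonalMap_section F A (decalageExtraDegeneracy B)
  have h₂ := quasiIso_diagonalMap_section F A' (decalageExtraDegeneracy B)
  -- The naturality square relating `F(f, const B_0)` to `F(f, decalage B)`; its two section maps
  -- are quasi-isomorphisms.
  have comm := (diagonalMap_comp F f (𝟙 _) (𝟙 A') (decalageExtraDegeneracy B).section_).trans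
    ((congrArg₂ (diagonalMap F) ((Category.comp_id f).trans (Category.id_comp f).symm)
      ((Category.id_comp _).trans (Category.comp_id _).symm)).trans
    (diagonalMap_comp F (𝟙 A) (decalageExtraDegeneracy B).section_ f (𝟙 (decalage B))).symm)
  have key := ((alternatingFaceMapComplex E).map_comp _ _).symm.trans
    ((congrArg (alternatingFaceMapComplex E).map comm).trans
      ((alternatingFaceMapComplex E).map_comp _ _))
  refine (quasiIso_iff_comp_left _ _ (hφ := h₁)).1 ?_
  refine cast (congrArg (fun φ => QuasiIso φ) key) ?_
  exact quasiIso_comp (hφ := this) (hφ' := h₂) _ _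

end QuasiIso

/-! ### The Künneth theorem by dimension shifting. -/

section Tensor

variable (k : Type w) [Field k]

open scoped TensorProduct

/-- The tensor product of vector spaces. -/
def tensorFunctor : ModuleCat.{v} k × ModuleCat.{v} k ⥤ ModuleCat.{v} k where
  obj M := ModuleCat.of k (M.1 ⊗[k] M.2)
  map f := ModuleCat.ofHom (TensorProduct.map f.1.hom f.2.hom)
  map_id M := by
    ext : 1
    exact TensorProduct.map_id
  map_comp f g := by
    ext : 1
    exact TensorProduct.map_comp _ _ _ _

/-- The functor `M ↦ M ⊗ V`. -/
abbrev tensorConst (V : ModuleCat.{v} k) : ModuleCat.{v} k ⥤ ModuleCat.{v} k :=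
  Functor.prod' (𝟭 _) ((Functor.const _).obj V) ⋙ tensorFunctor k

/-- The functor `M ↦ V ⊗ M`. -/
abbrev constTensor (V : ModuleCat.{v} k) : ModuleCat.{v} k ⥤ ModuleCat.{v} k :=
  Functor.prod' ((Functor.const _).obj V) (𝟭 _) ⋙ tensorFunctor k

instance (V : ModuleCat.{v} k) : (tensorConst k V).Additive where
  map_add := by
    intros
    ext : 1
    exact TensorProduct.map_add_left _ _ _

instance (V : ModuleCat.{v} k) : (constTensor k V).Additive where
  map_add := by
    intros
    ext : 1
    exact TensorProduct.map_add_right _ _ _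

instance (V : ModuleCat.{v} k) : (tensorConst k V).PreservesHomology := by
  refine ((tensorConst k V).exact_tfae.out 1 2).1 fun S hS => ?_
  rw [ShortComplex.ShortExact.moduleCat_exact_iff_function_exact] at hS ⊢
  exact Module.Flat.rTensor_exact V hS

theorem shortExact_map_constTensor (V : ModuleCat.{v} k) (S : ShortComplex (ModuleCat.{v} k))
    (hS : S.ShortExact) : (S.map (constTensor k V)).ShortExact := by
  revert S
  refine ((constTensor k V).exact_tfae.out 0 1).2 fun S hS => ?_
  rw [ShortComplex.ShortExact.moduleCat_exact_iff_function_exact] at hS ⊢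
  exact Module.Flat.lTensor_exact V hS

variable {k}

/-- Against a constant object the diagonal is the functor `- ⊗ V` applied degreewise, and this
functor is exact over a field. -/
theorem quasiIso_diagonalMap_const {A A' : SimplicialObject (ModuleCat.{v} k)} (f : A ⟶ A')
    [QuasiIso ((alternatingFaceMapComplex _).map f)] (V : ModuleCat.{v} k) :
    QuasiIso ((alternatingFaceMapComplex _).map (diagonalMap (tensorFunctor k) f
      (𝟙 ((SimplicialObject.const _).obj V)))) := by
  have h : QuasiIso ((alternatingFaceMapComplex _ ⋙ (tensorConst k V).mapHomologicalComplex _).map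
    f) := HomologicalComplex.quasiIso_map_of_preservesHomology
      ((alternatingFaceMapComplex _).map f) (tensorConst k V)
  rw [map_alternatingFaceMapComplex (tensorConst k V)] at h
  exact h

open Limits in
/-- The tensor product of a simplicial vector space `A` with a short exact sequence. -/
def tensorShortComplex (A : SimplicialObject (ModuleCat.{v} k))
    (S : ShortComplex (SimplexCategoryᵒᵖ ⥤ ModuleCat.{v} k)) :
    ShortComplex (ChainComplex (ModuleCat.{v} k) ℕ) where
  X₁ := (alternatingFaceMapComplex _).obj (diagonal (tensorFunctor k) A S.X₁)
  X₂ := (alternatingFaceMapComplex _).obj (diagonal (tensorFunctor k) A S.X₂)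
  X₃ := (alternatingFaceMapComplex _).obj (diagonal (tensorFunctor k) A S.X₃)
  f := (alternatingFaceMapComplex _).map (diagonalMap (tensorFunctor k) (𝟙 A) S.f)
  g := (alternatingFaceMapComplex _).map (diagonalMap (tensorFunctor k) (𝟙 A) S.g)
  zero := by
    ext n : 1
    have h := congrArg (constTensor k (A _⦋n⦌)).map (congr_app S.zero (op ⦋n⦌))
    have h' := ((constTensor k (A _⦋n⦌)).map_comp (S.f.app (op ⦋n⦌)) (S.g.app (op ⦋n⦌))).symm
    exact h'.trans (h.trans (Functor.map_zero _ _ _))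

theorem tensorShortComplex_shortExact (A : SimplicialObject (ModuleCat.{v} k))
    {S : ShortComplex (SimplexCategoryᵒᵖ ⥤ ModuleCat.{v} k)} (hS : S.ShortExact) :
    (tensorShortComplex A S).ShortExact := by
  refine HomologicalComplex.shortExact_of_degreewise_shortExact _ fun n => ?_
  have h := shortExact_map_constTensor k (A _⦋n⦌) _
    (hS.map_of_exact ((evaluation SimplexCategoryᵒᵖ (ModuleCat.{v} k)).obj (op ⦋n⦌)))
  refine ShortComplex.shortExact_of_iso (ShortComplex.isoMk (Iso.refl _) (Iso.refl _)
    (Iso.refl _) ?_ ?_) h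
  · exact (Category.id_comp _).trans (Category.comp_id _).symm
  · exact (Category.id_comp _).trans (Category.comp_id _).symm

/-- The morphism of short complexes induced by a map of simplicial vector spaces. -/
def tensorShortComplexMap {A A' : SimplicialObject (ModuleCat.{v} k)} (f : A ⟶ A')
    (S : ShortComplex (SimplexCategoryᵒᵖ ⥤ ModuleCat.{v} k)) :
    tensorShortComplex A S ⟶ tensorShortComplex A' S where
  τ₁ := (alternatingFaceMapComplex _).map (diagonalMap (tensorFunctor k) f (𝟙 S.X₁))
  τ₂ := (alternatingFaceMapComplex _).map (diagonalMap (tensorFunctor k) f (𝟙 S.X₂))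
  τ₃ := (alternatingFaceMapComplex _).map (diagonalMap (tensorFunctor k) f (𝟙 S.X₃))
  comm₁₂ := by
    dsimp only [tensorShortComplex]
    rw [← Functor.map_comp, ← Functor.map_comp, diagonalMap_comp, diagonalMap_comp]
    simp only [Category.id_comp, Category.comp_id]
  comm₂₃ := by
    dsimp only [tensorShortComplex]
    rw [← Functor.map_comp, ← Functor.map_comp, diagonalMap_comp, diagonalMap_comp]
    simp only [Category.id_comp, Category.comp_id]

/-- The kernel of the projection from the décalage. -/
def decalageSequence (B : SimplicialObject (ModuleCat.{v} k)) :
    ShortComplex (SimplexCategoryᵒᵖ ⥤ ModuleCat.{v} k) :=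
  ShortComplex.mk (X₂ := decalage B) (X₃ := B) (Limits.kernel.ι (decalageTo B)) (decalageTo B)
    (Limits.kernel.condition _)

theorem decalageSequence_shortExact (B : SimplicialObject (ModuleCat.{v} k)) :
    (decalageSequence B).ShortExact where
  exact := ShortComplex.exact_of_f_is_kernel _ (Limits.kernelIsKernel _)
  mono_f := Limits.equalizer.ι_mono (C := SimplexCategoryᵒᵖ ⥤ ModuleCat.{v} k)
  epi_g := by
    have (n : SimplexCategoryᵒᵖ) : Epi ((decalageSequence B).g.app n) := by
      -- The projection is `d_0`, split in each degree by `s_0`.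
      have h : B.σ (0 : Fin (n.unop.len + 1)) ≫ B.δ (0 : Fin (n.unop.len + 2)) = 𝟙 _ :=
        B.δ_comp_σ_self (i := 0)
      exact (SplitEpi.mk _ h).epi
    exact NatTrans.epi_of_epi_app _

/-- Künneth: tensoring with a simplicial vector space preserves quasi-isomorphisms. -/
theorem quasiIso_diagonalMap_tensor {A A' : SimplicialObject (ModuleCat.{v} k)} (f : A ⟶ A')
    [QuasiIso ((alternatingFaceMapComplex _).map f)] (B : SimplicialObject (ModuleCat.{v} k)) :
    QuasiIso ((alternatingFaceMapComplex _).map (diagonalMap (tensorFunctor k) f (𝟙 B))) := by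
  -- The induction on `n` must range over all `B`, because the five lemma for `B` uses the kernel of
  -- `decalageTo B`.
  suffices h : ∀ (n : ℕ) (B : SimplicialObject (ModuleCat.{v} k)),
      IsIso (HomologicalComplex.homologyMap ((alternatingFaceMapComplex _).map
        (diagonalMap (tensorFunctor k) f (𝟙 B))) n) by
    rw [quasiIso_iff]
    intro n
    rw [quasiIsoAt_iff_isIso_homologyMap]
    exact h n B
  intro n
  have hdec (B : SimplicialObject (ModuleCat.{v} k)) (i : ℕ) :
      IsIso (HomologicalComplex.homologyMap
        (tensorShortComplexMap f (decalageSequence B)).τ₂ i) := by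
    have := quasiIso_diagonalMap_decalage (tensorFunctor k) f (quasiIso_diagonalMap_const f) B
    rw [quasiIso_iff] at this
    have := this i
    rw [quasiIsoAt_iff_isIso_homologyMap] at this
    exact this
  -- Surjectivity in degree `n` comes first, for all `B`: injectivity for `B` needs surjectivity in
  -- the same degree for the kernel. In degree 0 the hypothesis `ih` is vacuous.
  have hepi (n : ℕ) (ih : ∀ j, (ComplexShape.down ℕ).Rel n j →
      ∀ (B : SimplicialObject (ModuleCat.{v} k)),
        IsIso (HomologicalComplex.homologyMap ((alternatingFaceMapComplex _).map
        (diagonalMap (tensorFunctor k) f (𝟙 B))) j)) (B : SimplicialObject (ModuleCat.{v} k)) :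
      Epi (HomologicalComplex.homologyMap ((alternatingFaceMapComplex _).map
        (diagonalMap (tensorFunctor k) f (𝟙 B))) n) := by
    have := hdec B
    refine HomologicalComplex.HomologySequence.epi_homologyMap_τ₃
      (tensorShortComplexMap f (decalageSequence B))
      (tensorShortComplex_shortExact A (decalageSequence_shortExact B))
      (tensorShortComplex_shortExact A' (decalageSequence_shortExact B)) n inferInstance
      (fun j hj => ?_) (fun j hj => inferInstance)
    have := ih j hj (decalageSequence B).X₁
    exact @IsIso.epi_of_iso _ _ _ _ _ this
  have hiso (n : ℕ) (ih : ∀ j, (ComplexShape.down ℕ).Rel n j →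
      ∀ (B : SimplicialObject (ModuleCat.{v} k)),
        IsIso (HomologicalComplex.homologyMap ((alternatingFaceMapComplex _).map
        (diagonalMap (tensorFunctor k) f (𝟙 B))) j)) (B : SimplicialObject (ModuleCat.{v} k)) :
      IsIso (HomologicalComplex.homologyMap ((alternatingFaceMapComplex _).map
        (diagonalMap (tensorFunctor k) f (𝟙 B))) n) := by
    have := hdec B
    exact HomologicalComplex.HomologySequence.isIso_homologyMap_τ₃
      (tensorShortComplexMap f (decalageSequence B))
      (tensorShortComplex_shortExact A (decalageSequence_shortExact B))
      (tensorShortComplex_shortExact A' (decalageSequence_shortExact B)) n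
      (hepi n ih _) inferInstance (fun j hj => ih j hj _) (fun j hj => inferInstance)
  induction n with
  | zero => exact hiso 0 fun j hj => by simp at hj
  | succ n ih =>
    refine hiso (n + 1) ?_
    rintro j hj
    obtain rfl : j = n := by simpa using hj
    exact ih

end Tensor

/-! ### Homology isomorphisms and finite powers. -/

section Powers

variable {k : Type w} [Field k]

theorem quasiIso_iff_of_iso {A A' B B' : SimplicialObject (ModuleCat.{v} k)} {f : A ⟶ A'}
    {g : B ⟶ B'} (e : A ≅ B) (e' : A' ≅ B') (h : e.hom ≫ g = f ≫ e'.hom) :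
    QuasiIso ((alternatingFaceMapComplex _).map f) ↔
      QuasiIso ((alternatingFaceMapComplex _).map g) := by
  rw [← quasiIso_iff_comp_left ((alternatingFaceMapComplex _).map e.hom)
    ((alternatingFaceMapComplex _).map g), ← Functor.map_comp, h, Functor.map_comp,
    quasiIso_iff_comp_right]

theorem freeModule_hom_ext {X : Type u} {M : ModuleCat.{max u w} k}
    {f g : ModuleCat.of k (X →₀ k) ⟶ M}
    (h : ∀ (x : X) (r : k), f.hom (Finsupp.single x r) = g.hom (Finsupp.single x r)) : f = g :=
  ModuleCat.hom_ext (Finsupp.lhom_ext h)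

theorem freeModule_tensor_hom_ext {X Y : Type u} {M : ModuleCat.{max u w} k}
    {f g : (tensorFunctor k).obj (ModuleCat.of k (X →₀ k), ModuleCat.of k (Y →₀ k)) ⟶ M}
    (h : ∀ (x : X) (r : k) (y : Y) (t : k),
      f.hom (TensorProduct.tmul k (Finsupp.single x r) (Finsupp.single y t)) =
        g.hom (TensorProduct.tmul k (Finsupp.single x r) (Finsupp.single y t))) : f = g :=
  ModuleCat.hom_ext (TensorProduct.ext (Finsupp.lhom_ext fun x r =>
    Finsupp.lhom_ext fun y t => h x r y t))

variable (k)

/-- The simplicial vector space `⦋n⦌ ↦ k[K_n ^ J]`. -/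
def powModule (J : Type u) (K : SSet.{u}) : SimplicialObject (ModuleCat.{max u w} k) where
  obj n := ModuleCat.of k ((J → K.obj n) →₀ k)
  map θ := ModuleCat.ofHom (Finsupp.lmapDomain k k fun x j => K.map θ (x j))
  map_id n := by
    ext x : 3
    simp
  map_comp θ η := by
    ext x : 3
    simp

/-- The functoriality of `k[K ^ J]` in `K`. -/
def powModuleMap (J : Type u) {K K' : SSet.{u}} (f : K ⟶ K') :
    powModule k J K ⟶ powModule k J K' where
  app n := ModuleCat.ofHom (Finsupp.lmapDomain k k fun x j => f.app n (x j))
  naturality n m θ := by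
    refine freeModule_hom_ext fun x r => ?_
    change Finsupp.mapDomain _ (Finsupp.mapDomain _ (Finsupp.single x r)) =
      Finsupp.mapDomain _ (Finsupp.mapDomain _ (Finsupp.single x r))
    simp only [Finsupp.mapDomain_single, NatTrans.naturality_apply]

/-- Reindexing of powers. -/
def powModuleIso {J J' : Type u} (e : J ≃ J') (K : SSet.{u}) :
    powModule k J K ≅ powModule k J' K :=
  NatIso.ofComponents
    (fun n => (Finsupp.domLCongr (e.arrowCongr (Equiv.refl (K.obj n)))).toModuleIso)
    (fun θ => by
      refine freeModule_hom_ext fun x r => ?_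
      change Finsupp.domLCongr (M := k) (R := k) _ (Finsupp.mapDomain _ (Finsupp.single x r)) =
        Finsupp.mapDomain _ (Finsupp.domLCongr (M := k) (R := k) _ (Finsupp.single x r))
      simp only [Finsupp.mapDomain_single, Finsupp.domLCongr_single]
      rfl)

/-- The decomposition `k[K ^ (J + 1)] = k[K] ⊗ k[K ^ J]`. -/
def powModuleOptionIso (J : Type u) (K : SSet.{u}) :
    diagonal (tensorFunctor k) ((freeModule k).obj K) (powModule k J K) ≅
      powModule k (Option J) K :=
  NatIso.ofComponents
    (fun n => ((finsuppTensorFinsupp' k (K.obj n) (J → K.obj n)).trans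
      (Finsupp.domLCongr (Equiv.piOptionEquivProd (β := fun _ => K.obj n)).symm)).toModuleIso)
    (fun {n m} θ => by
      refine freeModule_tensor_hom_ext fun x r y t => ?_
      change Finsupp.domLCongr (M := k) (R := k) _ (finsuppTensorFinsupp' k _ _
          (TensorProduct.tmul k (Finsupp.mapDomain _ (Finsupp.single x r))
            (Finsupp.mapDomain _ (Finsupp.single y t)))) =
        Finsupp.mapDomain _ (Finsupp.domLCongr (M := k) (R := k) _ (finsuppTensorFinsupp' k _ _
          (TensorProduct.tmul k (Finsupp.single x r) (Finsupp.single y t))))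
      simp only [Finsupp.mapDomain_single, finsuppTensorFinsupp'_single_tmul_single,
        Finsupp.domLCongr_single]
      congr 1
      funext j
      cases j <;> rfl)

theorem powModuleOptionIso_naturality (J : Type u) {K K' : SSet.{u}} (f : K ⟶ K') :
    (powModuleOptionIso k J K).hom ≫ powModuleMap k (Option J) f =
      diagonalMap (tensorFunctor k) ((freeModule k).map f) (powModuleMap k J f) ≫
        (powModuleOptionIso k J K').hom := by
  refine NatTrans.ext (funext fun n => ?_)
  refine freeModule_tensor_hom_ext fun x r y t => ?_
  change Finsupp.mapDomain _ (Finsupp.domLCongr (M := k) (R := k) _ (finsuppTensorFinsupp' k _ _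
      (TensorProduct.tmul k (Finsupp.single x r) (Finsupp.single y t)))) =
    Finsupp.domLCongr (M := k) (R := k) _ (finsuppTensorFinsupp' k _ _ (TensorProduct.tmul k
      (Finsupp.mapDomain _ (Finsupp.single x r)) (Finsupp.mapDomain _ (Finsupp.single y t))))
  simp only [Finsupp.mapDomain_single, finsuppTensorFinsupp'_single_tmul_single,
    Finsupp.domLCongr_single]
  congr 1
  funext j
  cases j <;> rfl

theorem powModuleIso_naturality {J J' : Type u} (e : J ≃ J') {K K' : SSet.{u}} (f : K ⟶ K') :
    (powModuleIso k e K).hom ≫ powModuleMap k J' f =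
      powModuleMap k J f ≫ (powModuleIso k e K').hom := by
  refine NatTrans.ext (funext fun n => ?_)
  refine freeModule_hom_ext fun x r => ?_
  change Finsupp.mapDomain _ (Finsupp.domLCongr (M := k) (R := k) _ (Finsupp.single x r)) =
    Finsupp.domLCongr (M := k) (R := k) _ (Finsupp.mapDomain _ (Finsupp.single x r))
  simp only [Finsupp.mapDomain_single, Finsupp.domLCongr_single]
  rfl

variable {k}

/-- The symmetry of the tensor product of simplicial vector spaces. -/
def diagonalTensorComm (A B : SimplicialObject (ModuleCat.{v} k)) :
    diagonal (tensorFunctor k) A B ≅ diagonal (tensorFunctor k) B A :=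
  NatIso.ofComponents (fun n => (TensorProduct.comm k (A.obj n) (B.obj n)).toModuleIso)
    (fun _ => ModuleCat.hom_ext (TensorProduct.ext' fun _ _ => rfl))

theorem quasiIso_diagonalMap_tensor_right {B B' : SimplicialObject (ModuleCat.{v} k)} (g : B ⟶ B')
    [QuasiIso ((alternatingFaceMapComplex _).map g)] (A : SimplicialObject (ModuleCat.{v} k)) :
    QuasiIso ((alternatingFaceMapComplex _).map (diagonalMap (tensorFunctor k) (𝟙 A) g)) :=
  (quasiIso_iff_of_iso (diagonalTensorComm B A) (diagonalTensorComm B' A) (by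
    refine NatTrans.ext (funext fun n => ?_)
    exact ModuleCat.hom_ext (TensorProduct.ext' fun _ _ => rfl))).1
    (quasiIso_diagonalMap_tensor g A)

theorem quasiIso_diagonalMap {A A' B B' : SimplicialObject (ModuleCat.{v} k)} (f : A ⟶ A')
    (g : B ⟶ B') [QuasiIso ((alternatingFaceMapComplex _).map f)]
    [QuasiIso ((alternatingFaceMapComplex _).map g)] :
    QuasiIso ((alternatingFaceMapComplex _).map (diagonalMap (tensorFunctor k) f g)) := by
  have h := diagonalMap_comp (tensorFunctor k) f (𝟙 B) (𝟙 A') g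
  rw [Category.comp_id, Category.id_comp] at h
  rw [← h, Functor.map_comp]
  have := quasiIso_diagonalMap_tensor f B
  have := quasiIso_diagonalMap_tensor_right g A'
  infer_instance

variable (k)

/-- Induction on the finite set `J`: for empty `J` both sides are constant of rank one, and each
further point contributes a tensor factor `k[K]`, handled by Künneth. -/
theorem quasiIso_powModuleMap (J : Type u) [Finite J] {K K' : SSet.{u}} (f : K ⟶ K')
    [QuasiIso ((alternatingFaceMapComplex _).map ((freeModule k).map f))] :
    QuasiIso ((alternatingFaceMapComplex _).map (powModuleMap k J f)) := by
  induction J using Finite.induction_empty_option with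
  | of_equiv e h =>
    exact (quasiIso_iff_of_iso (powModuleIso k e K) (powModuleIso k e K')
      (powModuleIso_naturality k e f)).1 h
  | h_empty =>
    have (n : SimplexCategoryᵒᵖ) : IsIso ((powModuleMap k PEmpty.{u + 1} f).app n) := by
      let e := Finsupp.domLCongr (R := k) (M := k)
        (Equiv.ofUnique (PEmpty.{u + 1} → K.obj n) (PEmpty.{u + 1} → K'.obj n))
      have : (powModuleMap k PEmpty.{u + 1} f).app n = e.toModuleIso.hom := by
        refine freeModule_hom_ext fun x r => ?_
        change Finsupp.mapDomain _ (Finsupp.single x r) =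
          Finsupp.domLCongr (M := k) (R := k) _ (Finsupp.single x r)
        rw [Finsupp.mapDomain_single, Finsupp.domLCongr_single]
        congr 1
        exact Subsingleton.elim _ _
      rw [this]
      exact e.toModuleIso.isIso_hom
    have := NatIso.isIso_of_isIso_app (powModuleMap k PEmpty.{u + 1} f)
    infer_instance
  | h_option h =>
    exact (quasiIso_iff_of_iso (powModuleOptionIso k _ K) (powModuleOptionIso k _ K')
      (powModuleOptionIso_naturality k _ f)).1 (quasiIso_diagonalMap _ _)

end Powers

/-! ### Homotopy equivalences in the linearized category. -/

section Linearization

variable (k : Type w) [Field k] {C : Type v} [Category.{u} C]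

/-- The chain complex `⋯ → K_2 → K_1 → K_0` of a simplicial object in the linearized category. -/
abbrev freeComplex (K : SimplicialObject C) : ChainComplex (Free k C) ℕ :=
  (alternatingFaceMapComplex (Free k C)).obj
    (((SimplicialObject.whiskering C (Free k C)).obj (Free.embedding k C)).obj K)

/-- The functoriality of `freeComplex`. -/
abbrev freeComplexMap {K K' : SimplicialObject C} (f : K ⟶ K') :
    freeComplex k K ⟶ freeComplex k K' :=
  (alternatingFaceMapComplex (Free k C)).map
    (((SimplicialObject.whiskering C (Free k C)).obj (Free.embedding k C)).map f)

/-- A natural identification of the maps from `T` with `J`-indexed families of elements. -/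
structure PowerRepresentation (U : C ⥤ Type u) (T : C) (J : Type u) where
  equiv (X : C) : (T ⟶ X) ≃ (J → U.obj X)
  equiv_comp {X Y : C} (t : T ⟶ X) (g : X ⟶ Y) :
    equiv Y (t ≫ g) = fun j => U.map g (equiv X t j)

/-- The simplicial vector space `⦋n⦌ ↦ k[Hom(T, K_n)]`. -/
abbrev homModule (T : C) : SimplicialObject C ⥤ SimplicialObject (ModuleCat.{max u w} k) :=
  (SimplicialObject.whiskering C (Free k C)).obj (Free.embedding k C) ⋙
    (SimplicialObject.whiskering (Free k C) (ModuleCat.{max u w} k)).obj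
      ((linearCoyoneda k (Free k C)).obj (op T))

variable {k}

theorem homModule_map_app_single (T : C) {K K' : SimplicialObject C} (f : K ⟶ K')
    (n : SimplexCategoryᵒᵖ) (t : T ⟶ K.obj n) (r : k) :
    (((homModule k T).map f).app n).hom (Finsupp.single t r) =
      Finsupp.single (t ≫ f.app n) r :=
  (Free.single_comp_single k C t (f.app n) r 1).trans (by rw [mul_one])

theorem homModule_obj_map_single (T : C) (K : SimplicialObject C)
    {n m : SimplexCategoryᵒᵖ} (θ : n ⟶ m) (t : T ⟶ K.obj n) (r : k) :
    (((homModule k T).obj K).map θ).hom (Finsupp.single t r) =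
      Finsupp.single (t ≫ K.map θ) r :=
  (Free.single_comp_single k C t (K.map θ) r 1).trans (by rw [mul_one])

variable (k)

/-- The simplicial vector space `k[Hom(T, K)]` as a power. -/
def homModuleIso {U : C ⥤ Type u} {T : C} {J : Type u} (r : PowerRepresentation U T J)
    (K : SimplicialObject C) : (homModule k T).obj K ≅ powModule k J (K ⋙ U) :=
  NatIso.ofComponents
    (fun n => (Finsupp.domLCongr (M := k) (R := k) (r.equiv (K.obj n))).toModuleIso)
    (fun θ => by
      refine freeModule_hom_ext fun x t => ?_
      change Finsupp.domLCongr (M := k) (R := k) _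
          ((((homModule k T).obj K).map θ).hom (Finsupp.single x t)) =
        Finsupp.mapDomain _ (Finsupp.domLCongr (M := k) (R := k) _ (Finsupp.single x t))
      refine (congrArg _ (homModule_obj_map_single T K θ x t)).trans ?_
      refine (Finsupp.domLCongr_single _ _ _).trans ?_
      refine Eq.trans ?_ (congrArg _ (Finsupp.domLCongr_single _ _ _)).symm
      refine Eq.trans ?_ Finsupp.mapDomain_single.symm
      exact congrArg (Finsupp.single · t) (r.equiv_comp x (K.map θ)))

/-- Morphisms out of `T` in `Free k C` are formal combinations of morphisms of `C`, so `Hom(T, -)`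
turns the complex of `K` into the chains of `k[(K ⋙ U) ^ J]`. -/
theorem quasiIso_homMap_freeComplexMap {U : C ⥤ Type u} {T : C} {J : Type u} [Finite J]
    (r : PowerRepresentation U T J) {K K' : SimplicialObject C} (f : K ⟶ K')
    [QuasiIso ((alternatingFaceMapComplex _).map
      ((freeModule k).map (Functor.whiskerRight f U)))] :
    QuasiIso (homMap k (𝓛 := Free k C) T (freeComplexMap k f)) := by
  have h := quasiIso_powModuleMap k J (Functor.whiskerRight f U)
  have h' : QuasiIso ((alternatingFaceMapComplex _).map ((homModule k T).map f)) := by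
    refine (quasiIso_iff_of_iso (homModuleIso k r K) (homModuleIso k r K') ?_).2 h
    refine NatTrans.ext (funext fun n => freeModule_hom_ext fun x t => ?_)
    change Finsupp.mapDomain _ (Finsupp.domLCongr (M := k) (R := k) _ (Finsupp.single x t)) =
      Finsupp.domLCongr (M := k) (R := k) _
        ((((homModule k T).map f).app n).hom (Finsupp.single x t))
    refine Eq.trans ?_ (congrArg _ (homModule_map_app_single T f n x t)).symm
    refine (congrArg _ (Finsupp.domLCongr_single _ _ _)).trans ?_
    refine Finsupp.mapDomain_single.trans (Eq.trans ?_ (Finsupp.domLCongr_single _ _ _).symm)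
    exact congrArg (Finsupp.single · t) (r.equiv_comp x (f.app n)).symm
  have e := map_alternatingFaceMapComplex ((linearCoyoneda k (Free k C)).obj (op T))
  change QuasiIso ((alternatingFaceMapComplex _ ⋙
    ((linearCoyoneda k (Free k C)).obj (op T)).mapHomologicalComplex _).map _)
  rw [e]
  exact h'

/-- A simplicial map which is a `k`-homology isomorphism induces a homotopy equivalence of
complexes of formal linear combinations of simplices. -/
theorem exists_homotopyEquiv_freeComplexMap (U : C ⥤ Type u) {K K' : SimplicialObject C}
    (hK : ∀ n, ∃ (J : Type u) (_ : Finite J), Nonempty (PowerRepresentation U (K.obj n) J))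
    (hK' : ∀ n, ∃ (J : Type u) (_ : Finite J), Nonempty (PowerRepresentation U (K'.obj n) J))
    (f : K ⟶ K') (hf : ∀ i, IsIso (homologyMap k (Functor.whiskerRight f U) i)) :
    ∃ e : HomotopyEquiv (freeComplex k K) (freeComplex k K'), e.hom = freeComplexMap k f := by
  have : QuasiIso (normalized.map ((freeModule k).map (Functor.whiskerRight f U))) := by
    rw [quasiIso_iff]
    intro i
    rw [quasiIsoAt_iff_isIso_homologyMap]
    exact hf i
  rw [quasiIso_normalized_map_iff] at this
  refine exists_homotopyEquiv (k := k) (freeComplexMap k f) (fun n => ?_) fun n => ?_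
  · obtain ⟨J, _, ⟨r⟩⟩ := hK (op ⦋n⦌)
    exact quasiIso_homMap_freeComplexMap k r f
  · obtain ⟨J, _, ⟨r⟩⟩ := hK' (op ⦋n⦌)
    exact quasiIso_homMap_freeComplexMap k r f

/-- Every set is the index set of the maps out of itself. -/
def typePowerRepresentation (T : Type u) : PowerRepresentation (𝟭 (Type u)) T T where
  equiv _ := TypeCat.homEquiv
  equiv_comp _ _ := rfl

open scoped Classical in
/-- Pointed maps out of `T` are families indexed by the complement of the base point. -/
def pointedPowerRepresentation (T : Pointed.{u}) :
    PowerRepresentation (forget Pointed.{u}) T {t : T.X // t ≠ T.point} where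
  equiv X :=
    { toFun g t := g.toFun t.1
      invFun φ := ⟨fun t => if h : t = T.point then X.point else φ ⟨t, h⟩, dif_pos rfl⟩
      left_inv g := by
        refine Pointed.Hom.ext (funext fun t => ?_)
        dsimp only
        split_ifs with h
        · rw [h, g.map_point]
        · rfl
      right_inv φ := funext fun t => dif_neg t.2 }
  equiv_comp _ _ := rfl

end Linearization

/-! ### Homotopies of total complexes. -/

section TotalHomotopy

variable {A : Type u} [Category.{v} A] [Preadditive A]
  {K L : HomologicalComplex₂ A (ComplexShape.up ℕ) (ComplexShape.down ℕ)}
  [K.HasTotal (ComplexShape.up ℤ)] [L.HasTotal (ComplexShape.up ℤ)] {φ ψ : K ⟶ L}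

open HomologicalComplex₂

/-- The map of total complexes given by maps which raise the second degree by one. -/
def totalShift (h : ∀ q p, (K.X q).X p ⟶ (L.X q).X (p + 1)) (i j : ℤ) :
    (K.total (ComplexShape.up ℤ)).X i ⟶ (L.total (ComplexShape.up ℤ)).X j :=
  -- The value is zero unless `j = i - 1`, which makes the map available for all `i` and `j`.
  K.totalDesc fun q p _ => h q p ≫ L.ιTotalOrZero (ComplexShape.up ℤ) q (p + 1) j

theorem ιTotal_totalShift (h : ∀ q p, (K.X q).X p ⟶ (L.X q).X (p + 1)) (i j : ℤ) (q p : ℕ)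
    (hqp : ComplexShape.π (ComplexShape.up ℕ) (ComplexShape.down ℕ)
      (ComplexShape.up ℤ) (q, p) = i) :
    K.ιTotal (ComplexShape.up ℤ) q p i hqp ≫ totalShift h i j =
      h q p ≫ L.ιTotalOrZero (ComplexShape.up ℤ) q (p + 1) j :=
  K.ι_totalDesc _ _ _ _

theorem π_apply (q p : ℕ) : ComplexShape.π (ComplexShape.up ℕ) (ComplexShape.down ℕ)
    (ComplexShape.up ℤ) (q, p) = (q : ℤ) - p := rfl

/-- A homotopy in the second direction which commutes with the first differential induces a
homotopy of total complexes. -/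
def totalHomotopy (h : ∀ q, Homotopy (φ.f q) (ψ.f q))
    (comm : ∀ q q' p p', (K.d q q').f p ≫ (h q').hom p p' = (h q).hom p p' ≫ (L.d q q').f p') :
    Homotopy (total.map φ (ComplexShape.up ℤ)) (total.map ψ (ComplexShape.up ℤ)) where
  hom := totalShift fun q p => (h q).hom p (p + 1)
  zero i j hij := by
    refine total.hom_ext _ fun q p hqp => ?_
    rw [ιTotal_totalShift, L.ιTotalOrZero_eq_zero, Limits.comp_zero, Limits.comp_zero]
    rw [π_apply] at hqp ⊢
    simp at hij
    push_cast
    omega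
  comm i := by
    rw [dNext_eq _ (show (ComplexShape.up ℤ).Rel i (i + 1) from rfl),
      prevD_eq _ (show (ComplexShape.up ℤ).Rel (i - 1) i by simp)]
    refine total.hom_ext _ fun q p hqp => ?_
    have hd₁ : K.d₁ (ComplexShape.up ℤ) q p (i + 1) ≫
        totalShift (L := L) (fun q p => (h q).hom p (p + 1)) (i + 1) i =
        (-(-1) ^ p : ℤˣ) • ((K.d q (q + 1)).f p ≫ (h (q + 1)).hom p (p + 1) ≫
          L.ιTotalOrZero (ComplexShape.up ℤ) (q + 1) (p + 1) i) := by
      rw [K.d₁_eq _ (show (ComplexShape.up ℕ).Rel q (q + 1) from rfl) p (i + 1)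
        (by rw [π_apply] at hqp ⊢; push_cast; omega), Linear.units_smul_comp, Category.assoc,
        ιTotal_totalShift]
      rfl
    have hd₂ : K.d₂ (ComplexShape.up ℤ) q p (i + 1) ≫
        totalShift (L := L) (fun q p => (h q).hom p (p + 1)) (i + 1) i =
        dNext p (h q).hom ≫ L.ιTotal (ComplexShape.up ℤ) q p i hqp := by
      cases p with
      | zero =>
        rw [K.d₂_eq_zero _ _ _ _ (by simp), dNext_eq_zero _ _ (by simp), Limits.zero_comp,
          Limits.zero_comp]
      | succ p =>
        rw [K.d₂_eq _ q (show (ComplexShape.down ℕ).Rel (p + 1) p from rfl) (i + 1)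
          (by rw [π_apply] at hqp ⊢; push_cast at hqp; omega), Linear.units_smul_comp,
          Category.assoc, ιTotal_totalShift, L.ιTotalOrZero_eq _ _ _ _ hqp,
          dNext_eq _ (show (ComplexShape.down ℕ).Rel (p + 1) p from rfl), Category.assoc]
        exact one_smul _ _
    have hp : ComplexShape.π (ComplexShape.up ℕ) (ComplexShape.down ℕ) (ComplexShape.up ℤ)
        (q, p + 1) = i - 1 := by
      rw [π_apply] at hqp ⊢
      push_cast
      omega
    have hd₁' : L.d₁ (ComplexShape.up ℤ) q (p + 1) i = (-(-1) ^ (p + 1) : ℤˣ) •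
        ((L.d q (q + 1)).f (p + 1) ≫ L.ιTotalOrZero (ComplexShape.up ℤ) (q + 1) (p + 1) i) :=
      L.d₁_eq' _ (show (ComplexShape.up ℕ).Rel q (q + 1) from rfl) (p + 1) i
    have hd₂' : L.d₂ (ComplexShape.up ℤ) q (p + 1) i =
        (L.X q).d (p + 1) p ≫ L.ιTotal (ComplexShape.up ℤ) q p i hqp :=
      (L.d₂_eq _ q (show (ComplexShape.down ℕ).Rel (p + 1) p from rfl) i hqp).trans (one_smul _ _)
    -- The terms containing the first differential cancel between `e₁` and `e₂`: its sign `-(-1)^p`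
    -- changes when `h` raises `p` by one. What remains is the homotopy identity for fixed `q`.
    have e₁ : K.ιTotal (ComplexShape.up ℤ) q p i hqp ≫ (K.total (ComplexShape.up ℤ)).d i (i + 1) ≫
        totalShift (L := L) (fun q p => (h q).hom p (p + 1)) (i + 1) i =
        (-(-1) ^ p : ℤˣ) • ((K.d q (q + 1)).f p ≫ (h (q + 1)).hom p (p + 1) ≫
          L.ιTotalOrZero (ComplexShape.up ℤ) (q + 1) (p + 1) i) +
        dNext p (h q).hom ≫ L.ιTotal (ComplexShape.up ℤ) q p i hqp := by
      rw [total_d, Preadditive.add_comp, Preadditive.comp_add, ι_D₁_assoc, ι_D₂_assoc, hd₁, hd₂]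
    have e₂ : K.ιTotal (ComplexShape.up ℤ) q p i hqp ≫
        totalShift (L := L) (fun q p => (h q).hom p (p + 1)) i (i - 1) ≫
          (L.total (ComplexShape.up ℤ)).d (i - 1) i =
        ((-1) ^ p : ℤˣ) • ((K.d q (q + 1)).f p ≫ (h (q + 1)).hom p (p + 1) ≫
          L.ιTotalOrZero (ComplexShape.up ℤ) (q + 1) (p + 1) i) +
        prevD p (h q).hom ≫ L.ιTotal (ComplexShape.up ℤ) q p i hqp := by
      rw [← Category.assoc, ιTotal_totalShift, L.ιTotalOrZero_eq _ _ _ _ hp, Category.assoc,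
        total_d, Preadditive.comp_add, Preadditive.comp_add, ι_D₁, ι_D₂, hd₁', hd₂',
        prevD_eq _ (show (ComplexShape.down ℕ).Rel (p + 1) p from rfl), reassoc_of% comm,
        Linear.comp_units_smul, pow_succ, Category.assoc, mul_neg_one, neg_neg]
    rw [Preadditive.comp_add, Preadditive.comp_add, ιTotal_map, ιTotal_map, e₁, e₂, (h q).comm p,
      Units.neg_smul, Preadditive.add_comp, Preadditive.add_comp]
    abel

variable {X Y : HomologicalComplex₂ A (ComplexShape.down ℕ) (ComplexShape.up ℕ)}

/-- The map of flipped bicomplexes induced by a map of bicomplexes. -/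
abbrev flipMap (φ : X ⟶ Y) : X.flip ⟶ Y.flip :=
  (HomologicalComplex₂.flipFunctor _ _ _).map φ

/-- Homotopic maps of chain complexes of cochain complexes have homotopic total maps. -/
def totalFlipHomotopy [X.flip.HasTotal (ComplexShape.up ℤ)] [Y.flip.HasTotal (ComplexShape.up ℤ)]
    {φ ψ : X ⟶ Y} (h : Homotopy φ ψ) :
    Homotopy (total.map (flipMap φ) (ComplexShape.up ℤ))
      (total.map (flipMap ψ) (ComplexShape.up ℤ)) :=
  totalHomotopy
    (fun q =>
      { hom p p' := (h.hom p p').f q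
        zero p p' hp := by rw [h.zero p p' hp]; rfl
        comm p := by
          refine (congrArg (fun f => HomologicalComplex.Hom.f f q) (h.comm p)).trans ?_
          refine congrArg (· + (ψ.f p).f q) (congrArg₂ (· + ·) ?_ ?_)
          · cases p with
            | zero =>
              exact (congrArg (fun f => f.f q) (dNext_eq_zero h.hom 0 (by simp))).trans
                (dNext_eq_zero (C := X.flip.X q) (D := Y.flip.X q) _ 0 (by simp)).symm
            | succ p =>
              exact (congrArg (fun f => f.f q) (dNext_eq h.hom
                (show (ComplexShape.down ℕ).Rel (p + 1) p from rfl))).trans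
                (dNext_eq (C := X.flip.X q) (D := Y.flip.X q) (fun p p' => (h.hom p p').f q)
                  (show (ComplexShape.down ℕ).Rel (p + 1) p from rfl)).symm
          · exact (congrArg (fun f => f.f q) (prevD_eq h.hom
              (show (ComplexShape.down ℕ).Rel (p + 1) p from rfl))).trans
              (prevD_eq (C := X.flip.X q) (D := Y.flip.X q) (fun p p' => (h.hom p p').f q)
                (show (ComplexShape.down ℕ).Rel (p + 1) p from rfl)).symm })
    -- The components of `h` are themselves morphisms of cochain complexes.
    (fun q q' p p' => ((h.hom p p').comm q q').symm)

end TotalHomotopy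

/-! ### Linear extension of functors. -/

section Lift

variable (k : Type w) [Field k] {C D : Type*} [Category* C] [Category* D] [Preadditive D]
  [Linear k D]

/-- The linear extension of a functor to the linearized category. -/
def linearLift (F : C ⥤ D) : Free k C ⥤ D where
  obj X := F.obj X
  map {X Y} f := Finsupp.linearCombination k (fun g : @Quiver.Hom C _ X Y => F.map g)
    (show (@Quiver.Hom C _ X Y) →₀ k from f)
  map_id X := by
    refine (Finsupp.linearCombination_single _ _ _).trans ?_
    rw [one_smul]
    exact F.map_id X
  map_comp {X Y Z} f g := by
    have h₁ : ∀ {X Y : C} (f : X ⟶ Y) (r : k), Finsupp.linearCombination k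
        (fun g : X ⟶ Y => F.map g) (Finsupp.single f r) = r • F.map f :=
      fun f r => Finsupp.linearCombination_single _ _ _
    have h₂ : ∀ {X Y Z : C} (f : X ⟶ Y) (g : Y ⟶ Z) (r s : k),
        (r * s) • F.map (f ≫ g) = (r • F.map f) ≫ (s • F.map g) := fun f g r s => by
      rw [F.map_comp, Linear.smul_comp, Linear.comp_smul, smul_smul]
    let Φ (X Y : C) := Finsupp.linearCombination k (fun g : X ⟶ Y => F.map g)
    change Φ X Z (f ≫ g) = Φ X Y f ≫ Φ Y Z g
    refine Finsupp.induction_linear f ?_ ?_ ?_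
    · exact (congrArg (Φ X Z) Limits.zero_comp).trans ((map_zero _).trans
        ((congrArg (· ≫ Φ Y Z g) (map_zero (Φ X Y))).trans Limits.zero_comp).symm)
    · intro f₁ f₂ w₁ w₂
      refine (congrArg (Φ X Z) (Preadditive.add_comp (C := Free k C) _ _ _ f₁ f₂ g)).trans ?_
      refine ((map_add _ _ _).trans (congrArg₂ _ w₁ w₂)).trans ?_
      exact (Preadditive.add_comp _ _ _ _ _ _).symm.trans
        (congrArg (· ≫ Φ Y Z g) (map_add (Φ X Y) _ _).symm)
    · intro f' r
      refine Finsupp.induction_linear g ?_ ?_ ?_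
      · exact (congrArg (Φ X Z) Limits.comp_zero).trans ((map_zero _).trans
          ((congrArg (Φ X Y _ ≫ ·) (map_zero (Φ Y Z))).trans Limits.comp_zero).symm)
      · intro g₁ g₂ w₁ w₂
        refine (congrArg (Φ X Z) (Preadditive.comp_add (C := Free k C) _ _ _ _ g₁ g₂)).trans ?_
        refine ((map_add _ _ _).trans (congrArg₂ _ w₁ w₂)).trans ?_
        exact (Preadditive.comp_add _ _ _ _ _ _).symm.trans
          (congrArg (Φ X Y _ ≫ ·) (map_add (Φ Y Z) _ _).symm)
      · intro g' s
        refine (congrArg (Φ X Z) (Free.single_comp_single k C f' g' r s)).trans ?_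
        refine (h₁ _ _).trans (Eq.trans ?_ (congrArg₂ (· ≫ ·) (h₁ f' r) (h₁ g' s)).symm)
        exact h₂ f' g' r s

instance (F : C ⥤ D) : (linearLift k F).Additive where
  map_add {X Y f g} := map_add (Finsupp.linearCombination k
    (fun g : @Quiver.Hom C _ X Y => F.map g)) f g

/-- Stated as an equality of functors so that `exists_homotopyEquiv_comp` can rewrite along it on
objects and morphisms together. -/
theorem embedding_comp_linearLift (F : C ⥤ D) : Free.embedding k C ⋙ linearLift k F = F :=
  CategoryTheory.Functor.ext (fun _ => rfl) fun X Y f => by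
    refine ((Finsupp.linearCombination_single _ _ _).trans (one_smul k (F.map f))).trans ?_
    exact ((Category.id_comp _).trans (Category.comp_id _)).symm

/-- A simplicial map which is a `k`-homology isomorphism induces a homotopy equivalence after
the application of a functor to a `k`-linear category. -/
theorem exists_homotopyEquiv_comp {C : Type v} [Category.{u} C]
    (U : C ⥤ Type u) {K K' : SimplicialObject C}
    (hK : ∀ n, ∃ (J : Type u) (_ : Finite J), Nonempty (PowerRepresentation U (K.obj n) J))
    (hK' : ∀ n, ∃ (J : Type u) (_ : Finite J), Nonempty (PowerRepresentation U (K'.obj n) J))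
    (f : K ⟶ K') (hf : ∀ i, IsIso (homologyMap k (Functor.whiskerRight f U) i)) (F : C ⥤ D) :
    ∃ e : HomotopyEquiv
      ((alternatingFaceMapComplex D).obj (((SimplicialObject.whiskering C D).obj F).obj K))
      ((alternatingFaceMapComplex D).obj (((SimplicialObject.whiskering C D).obj F).obj K')),
      e.hom = (alternatingFaceMapComplex D).map
        (((SimplicialObject.whiskering C D).obj F).map f) := by
  obtain ⟨e, he⟩ := exists_homotopyEquiv_freeComplexMap k U hK hK' f hf
  have h : (SimplicialObject.whiskering C (Free k C)).obj (Free.embedding k C) ⋙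
      alternatingFaceMapComplex (Free k C) ⋙ (linearLift k F).mapHomologicalComplex _ =
      (SimplicialObject.whiskering C D).obj F ⋙ alternatingFaceMapComplex D := by
    rw [map_alternatingFaceMapComplex, ← Functor.assoc]
    exact congrArg (fun G => (SimplicialObject.whiskering C D).obj G ⋙
      alternatingFaceMapComplex D) (embedding_comp_linearLift k F)
  suffices ∃ e : HomotopyEquiv
      (((SimplicialObject.whiskering C D).obj F ⋙ alternatingFaceMapComplex D).obj K)
      (((SimplicialObject.whiskering C D).obj F ⋙ alternatingFaceMapComplex D).obj K'),
      e.hom = ((SimplicialObject.whiskering C D).obj F ⋙ alternatingFaceMapComplex D).map f from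
    this
  rw [← h]
  exact ⟨(linearLift k F).mapHomotopyEquiv e,
    congrArg (fun φ => ((linearLift k F).mapHomologicalComplex _).map φ) he⟩

end Lift

/-! ### From the unnormalized to the normalized bicomplex. -/

section Comparison

variable (k : Type w) [Field k]

/-- Evaluation in degree `q` is additive, so it commutes with the alternating sum. This matches the
rows of the flipped bicomplex with the chains of `cochainsSimplicial`. -/
theorem alternatingFaceMapComplex_d_f {A : Type u} [Category.{v} A] [Preadditive A]
    (S : SimplicialObject (CochainComplex A ℕ)) (q p p' : ℕ) :
    (((alternatingFaceMapComplex _).obj S).d p p').f q =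
      ((alternatingFaceMapComplex A).obj
        (((SimplicialObject.whiskering _ _).obj
          (HomologicalComplex.eval A _ q)).obj S)).d p p' := by
  by_cases h : (ComplexShape.down ℕ).Rel p p'
  · obtain rfl : p' + 1 = p := h
    rw [alternatingFaceMapComplex_obj_d, alternatingFaceMapComplex_obj_d]
    refine ((HomologicalComplex.eval A _ q).map_sum _ _).trans ?_
    exact Finset.sum_congr rfl fun i _ => (HomologicalComplex.eval A _ q).map_zsmul
  · rw [HomologicalComplex.shape _ _ _ h, HomologicalComplex.shape _ _ _ h]
    rfl

/-- The unnormalized version of the bicomplex of a cosimplicial space, with the two indices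
exchanged. -/
def cochainsChains : (CosimplicialObject TopCat.{v})ᵒᵖ ⥤
    ChainComplex (CochainComplex (ModuleCat.{max v w} k) ℕ) ℕ where
  obj Z := (alternatingFaceMapComplex _).obj (Z.unop.op ⋙ singularCochains k)
  map g := (alternatingFaceMapComplex _).map
    (Functor.whiskerRight (NatTrans.op g.unop) (singularCochains k))
  map_id Z := by
    refine (congrArg (alternatingFaceMapComplex _).map ?_).trans
      ((alternatingFaceMapComplex _).map_id _)
    exact NatTrans.ext (funext fun n => (singularCochains k).map_id _)
  map_comp g h := by
    refine (congrArg (alternatingFaceMapComplex _).map ?_).trans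
      ((alternatingFaceMapComplex _).map_comp _ _)
    exact NatTrans.ext (funext fun n => (singularCochains k).map_comp _ _)

/-- The normalized bicomplex, as a direct factor of the unnormalized one. -/
def bicomplexInclusion (Z : (CosimplicialObject TopCat.{v})ᵒᵖ) :
    (bicomplex k).obj Z ⟶ HomologicalComplex₂.flip ((cochainsChains k).obj Z) where
  f q :=
    { f p := (ofNormalized ((cochainsSimplicial k q).obj Z)).f p
      comm' p p' _ := (congrArg _
          (alternatingFaceMapComplex_d_f (Z.unop.op ⋙ singularCochains k) q p p')).trans
        ((ofNormalized ((cochainsSimplicial k q).obj Z)).comm p p') }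
  comm' q q' _ := by
    ext p : 1
    exact HomologicalComplex.congr_hom
      (ofNormalized_naturality (coboundary k Z q q')) p

/-- The projection of the unnormalized bicomplex onto the normalized one. -/
def bicomplexProjection (Z : (CosimplicialObject TopCat.{v})ᵒᵖ) :
    HomologicalComplex₂.flip ((cochainsChains k).obj Z) ⟶ (bicomplex k).obj Z where
  f q :=
    { f p := (toNormalized ((cochainsSimplicial k q).obj Z)).f p
      comm' p p' _ := ((toNormalized ((cochainsSimplicial k q).obj Z)).comm p p').trans
        (congrArg (· ≫ _)
          (alternatingFaceMapComplex_d_f (Z.unop.op ⋙ singularCochains k) q p p').symm) }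
  comm' q q' _ := by
    ext p : 1
    exact (HomologicalComplex.congr_hom
      (toNormalized_naturality (coboundary k Z q q')) p).symm

theorem bicomplexInclusion_comp_bicomplexProjection (Z : (CosimplicialObject TopCat.{v})ᵒᵖ) :
    bicomplexInclusion k Z ≫ bicomplexProjection k Z = 𝟙 _ := by
  ext q p : 2
  exact HomologicalComplex.congr_hom
    (ofNormalized_comp_toNormalized ((cochainsSimplicial k q).obj Z)) p

/-- On each arrow, the normalized bicomplex functor is a retract of the unnormalized one. -/
def bicomplexRetract {X Y : (CosimplicialObject TopCat.{v})ᵒᵖ} (g : X ⟶ Y) :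
    RetractArrow ((bicomplex k).map g) (flipMap ((cochainsChains k).map g)) where
  i := Arrow.homMk (bicomplexInclusion k X) (bicomplexInclusion k Y) (by
    ext q p : 2
    exact HomologicalComplex.congr_hom
      (ofNormalized_naturality ((cochainsSimplicial k q).map g)) p)
  r := Arrow.homMk (bicomplexProjection k X) (bicomplexProjection k Y) (by
    ext q p : 2
    exact (HomologicalComplex.congr_hom
      (toNormalized_naturality ((cochainsSimplicial k q).map g)) p).symm)
  retract := Arrow.hom_ext _ _ (bicomplexInclusion_comp_bicomplexProjection k X)
    (bicomplexInclusion_comp_bicomplexProjection k Y)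

/-- Flipping and totalizing turns `e` into a homotopy equivalence, and quasi-isomorphisms are stable
under retracts. -/
theorem quasiIso_realization_map {X Y : (CosimplicialObject TopCat.{v})ᵒᵖ} (g : X ⟶ Y)
    (e : HomotopyEquiv ((cochainsChains k).obj X) ((cochainsChains k).obj Y))
    (he : e.hom = (cochainsChains k).map g) : QuasiIso ((realization k).map g) := by
  let T := HomologicalComplex₂.totalFunctor (ModuleCat.{max v w} k) (ComplexShape.up ℕ)
    (ComplexShape.down ℕ) (ComplexShape.up ℤ)
  let Φ : ChainComplex (CochainComplex (ModuleCat.{max v w} k) ℕ) ℕ ⥤ _ :=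
    HomologicalComplex₂.flipFunctor _ _ _ ⋙ T
  let e' : HomotopyEquiv (Φ.obj ((cochainsChains k).obj X)) (Φ.obj ((cochainsChains k).obj Y)) :=
    { hom := Φ.map e.hom
      inv := Φ.map e.inv
      homotopyHomInvId := (Homotopy.ofEq (Φ.map_comp _ _).symm).trans
        ((totalFlipHomotopy e.homotopyHomInvId).trans (Homotopy.ofEq (Φ.map_id _)))
      homotopyInvHomId := (Homotopy.ofEq (Φ.map_comp _ _).symm).trans
        ((totalFlipHomotopy e.homotopyInvHomId).trans (Homotopy.ofEq (Φ.map_id _))) }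
  have h : HomologicalComplex.quasiIso _ _ (Φ.map e.hom) :=
    homotopyEquivalences_le_quasiIso _ _ _ ⟨e', rfl⟩
  rw [he] at h
  exact (HomologicalComplex.quasiIso _ _).of_retract ((bicomplexRetract k g).map T) h

end Comparison

/-! ### Mapping spaces as functors of the source set. -/

section MappingSpace

/-- The contravariant functor of maps into a space, as a functor to `TopCatᵒᵖ`. -/
def mapsTo (Y : TopCat.{v}) : Type u ⥤ TopCat.{max u v}ᵒᵖ where
  obj S := op (TopCat.of (S → Y))
  map f := (TopCat.ofHom
    { toFun := fun φ x => φ (f x)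
      continuous_toFun := by fun_prop }).op
  map_id _ := rfl
  map_comp _ _ := rfl

/-- The contravariant functor of pointed maps into a space, as a functor to `TopCatᵒᵖ`. -/
def pointedMapsTo (Y : TopCat.{v}) (y₀ : Y) : Pointed.{u} ⥤ TopCat.{max u v}ᵒᵖ where
  obj S := op (TopCat.of (PointedMaps S Y y₀))
  map f := (TopCat.ofHom (PointedMaps.precomp f Y y₀)).op
  map_id _ := rfl
  map_comp _ _ := rfl

end MappingSpace

end MappingCochains

end

theorem lemma2 (k : Type w) [Field k] :
    (∀ (K K' : SSet.{u}) (_ : ∀ n, Finite (K.obj n)) (_ : ∀ n, Finite (K'.obj n))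
      (f : K ⟶ K') (_ : ∀ i, IsIso (MappingCochains.homologyMap k f i)) (Y : TopCat.{v}),
      QuasiIso ((MappingCochains.realization k).map
        ((MappingCochains.mappingSpace Y).map f.op).op)) ∧
    (∀ (K K' : SimplicialObject Pointed.{u})
      (_ : ∀ n, Finite (K.obj n)) (_ : ∀ n, Finite (K'.obj n)) (f : K ⟶ K')
      (_ : ∀ i, IsIso (MappingCochains.homologyMap k (MappingCochains.forgetPoint.map f) i))
      (Y : TopCat.{v}) (y₀ : Y),
      QuasiIso ((MappingCochains.realization k).map
        ((MappingCochains.pointedMappingSpace Y y₀).map f.op).op)) := by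
  refine ⟨fun K K' hK hK' f hf Y => ?_, fun K K' hK hK' f hf Y y₀ => ?_⟩
  · obtain ⟨e, he⟩ := MappingCochains.exists_homotopyEquiv_comp k (𝟭 (Type u))
      (fun n => ⟨K.obj n, hK n, ⟨MappingCochains.typePowerRepresentation _⟩⟩)
      (fun n => ⟨K'.obj n, hK' n, ⟨MappingCochains.typePowerRepresentation _⟩⟩) f hf
      (MappingCochains.mapsTo Y ⋙ MappingCochains.singularCochains k)
    -- Levelwise application of `mapsTo Y` followed by singular cochains agrees by definition with
    -- `cochainsChains` of the mapping space.
    exact MappingCochains.quasiIso_realization_map k _ e he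
  · have h (S : Pointed.{u}) (hS : Finite S) : Finite {t : S.X // t ≠ S.point} :=
      @Subtype.finite S.X hS _
    obtain ⟨e, he⟩ := MappingCochains.exists_homotopyEquiv_comp k (forget Pointed.{u})
      (fun n => ⟨_, h _ (hK n), ⟨MappingCochains.pointedPowerRepresentation _⟩⟩)
      (fun n => ⟨_, h _ (hK' n), ⟨MappingCochains.pointedPowerRepresentation _⟩⟩) f hf
      (MappingCochains.pointedMapsTo Y y₀ ⋙ MappingCochains.singularCochains k)
    exact MappingCochains.quasiIso_realization_map k _ e he
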